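/- All systems are finite tensor products of Hilbert spaces of odd prime dimension (the empty product being the trivial one-dimensional system); $d_A$ is the dimension of $A$. **Discrete Wigner function.** On a factor of odd prime dimension $d$ let $X|j\rangle=|j\oplus 1\rangle$, $Z|j\rangle=\omega^j|j\rangle$ with $\omega=e^{2\pi i/d}$, and let $T_{(a_1,a_2)}=\tau^{-a_1a_2}Z^{a_1}X^{a_2}$ with $\tau=e^{(d+1)\pi i/d}$, $(a_1,a_2)\in\mathbb Z_d^2$; on a composite system, $T_{u\oplus v}=T_u\otimes T_v$. Put $A_0=\frac1{d}\sum_u T_u$ and $A_u=T_uA_0T_u^\dagger$, where $d$ is now the total dimension. The discrete Wigner function of an operator $V$ is $W_V(u)=\frac1d\operatorname{Tr}[A_uV]$, and $\|V\|_{W,1}=\sum_u|W_V(u)|$. Let $\mathcal W_+$ be the set of states with non-negative Wigner function. **CPWP maps and superchannels.** A quantum channel is a completely positive trace-preserving linear map. A Hermiticity-preserving linear map $\Pi_{A\to B}$ is *completely positive-Wigner-preserving* (CPWP) if $(\mathrm{id}_R\otimes\Pi)(\rho_{RA})\in\mathcal W_+$ for every system $R$ and every $\rho_{RA}\in\mathcal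 W_+$. A *superchannel* $\Xi_{(A\to B)\to(C\to D)}$ is a linear map from linear maps $A\to B$ to linear maps $C\to D$ such that $(\mathrm{id}_R\otimes\Xi)(\mathcal N_{RA\to RB})$ is a quantum channel for every system $R$ and every quantum channel $\mathcal N_{RA\to RB}$. It is a *CPWP superchannel* if moreover $(\mathrm{id}_R\otimes\Xi)(\mathcal N_{RA\to RB})$ is CPWP for every system $R$ and every CPWP channel $\mathcal N_{RA\to RB}$. **Generalized thauma.** The mana of a completely positive map $\mathcal E_{A\to B}$ is $\mathcal M(\mathcal E)=\log\max_u\|\mathcal E(A_u)\|_{W,1}$ (with $\log 0=-\infty$). A *generalized divergence* is a function $\mathbf D(\rho\|\sigma)\in[-\infty,\infty]$ of a state $\rho$ and a positive semi-definite operator $\sigma$ on the same (arbitrary) system that obeys data processing: $\mathbf D(\rho\|\sigma)\ge\mathbf D(\mathcal N(\rho)\|\mathcal N(\sigma))$ for every quantum channel $\mathcal N$. For a quantum channel $\mathcal N_{A\to B}$ and a completely positive map $\mathcal E_{A\to B}$ put $$\mathbf D(\mathcal N\|\mathcal E)=\sup_{\psi_{RA}}\mathbf D\big((\mathrm{id}_R\otimes\mathcal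 N)(\psi_{RA})\,\big\|\,(\mathrm{id}_R\otimes\mathcal E)(\psi_{RA})\big),$$ the supremum being over pure states $\psi_{RA}$ with $R$ isomorphic to $A$, and define the *generalized thauma* $$\boldsymbol\theta(\mathcal N)=\inf\{\mathbf D(\mathcal N\|\mathcal E):\ \mathcal E_{A\to B}\text{ completely positive},\ \mathcal M(\mathcal E)\le 0\}.$$ **Theorem (monotonicity).** For every generalized divergence $\mathbf D$, every quantum channel $\mathcal N_{A\to B}$ and every CPWP superchannel $\Xi_{(A\to B)\to(C\to D)}$, $$\boldsymbol\theta(\mathcal N)\ \ge\ \boldsymbol\theta(\Xi(\mathcal N)).$$ -/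

import Mathlib

open scoped ComplexOrder Kronecker

noncomputable section

/-- A quantum system: a tensor product of finitely many Hilbert spaces of odd prime dimension.
The empty tensor product (the trivial one-dimensional system) is `unit`. -/
inductive QSystem : Type
  | unit : QSystem
  | prime (p : ℕ) (hp : p.Prime) (hodd : Odd p) : QSystem
  | tensor (A B : QSystem) : QSystem

namespace QSystem

/-- Labels of the standard (computational) basis. -/
@[reducible] def Basis : QSystem → Type
  | unit => Unit
  | prime p _ _ => ZMod p
  | tensor A B => A.Basis × B.Basis

/-- Points of the discrete phase space: `ℤ_p × ℤ_p` for each factor of odd prime dimension `p`. -/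
@[reducible] def Phase : QSystem → Type
  | unit => Unit
  | prime p _ _ => ZMod p × ZMod p
  | tensor A B => A.Phase × B.Phase

instance instFintypeBasis : (A : QSystem) → Fintype A.Basis
  | unit => inferInstanceAs (Fintype Unit)
  | prime p hp _ => haveI : NeZero p := ⟨hp.ne_zero⟩; inferInstanceAs (Fintype (ZMod p))
  | tensor A B =>
    haveI := instFintypeBasis A; haveI := instFintypeBasis B
    inferInstanceAs (Fintype (A.Basis × B.Basis))

instance instDecidableEqBasis : (A : QSystem) → DecidableEq A.Basis
  | unit => inferInstanceAs (DecidableEq Unit)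
  | prime p _ _ => inferInstanceAs (DecidableEq (ZMod p))
  | tensor A B =>
    haveI := instDecidableEqBasis A; haveI := instDecidableEqBasis B
    inferInstanceAs (DecidableEq (A.Basis × B.Basis))

instance instFintypePhase : (A : QSystem) → Fintype A.Phase
  | unit => inferInstanceAs (Fintype Unit)
  | prime p hp _ => haveI : NeZero p := ⟨hp.ne_zero⟩; inferInstanceAs (Fintype (ZMod p × ZMod p))
  | tensor A B =>
    haveI := instFintypePhase A; haveI := instFintypePhase B
    inferInstanceAs (Fintype (A.Phase × B.Phase))

/-- The origin of phase space. -/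
def origin : (A : QSystem) → A.Phase
  | unit => ()
  | prime _ _ _ => (0, 0)
  | tensor A B => (A.origin, B.origin)

/-- The dimension of the Hilbert space. -/
def dim (A : QSystem) : ℕ := Fintype.card A.Basis

/-- Linear operators on the Hilbert space, as matrices in the standard basis. -/
abbrev Op (A : QSystem) : Type := Matrix A.Basis A.Basis ℂ

end QSystem

open QSystem (Op)

/-! ### Heisenberg--Weyl operators, phase-space point operators, discrete Wigner function -/

/-- `X |j⟩ = |j ⊕ 1⟩`. -/
def shiftOp (p : ℕ) : Matrix (ZMod p) (ZMod p) ℂ :=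
  Matrix.of fun i j => if i = j + 1 then 1 else 0

/-- `Z |j⟩ = ω ^ j |j⟩` with `ω = exp (2 π i / p)`. -/
def clockOp (p : ℕ) : Matrix (ZMod p) (ZMod p) ℂ :=
  Matrix.diagonal fun j => Complex.exp (2 * Real.pi * Complex.I / p) ^ j.val

/-- `T_u = τ ^ (- a₁ a₂) Z ^ a₁ X ^ a₂` for `u = (a₁, a₂)`, with `τ = exp ((p + 1) π i / p)`. -/
def primeHW (p : ℕ) [NeZero p] (u : ZMod p × ZMod p) : Matrix (ZMod p) (ZMod p) ℂ :=
  Complex.exp ((p + 1) * Real.pi * Complex.I / p) ^ (-((u.1.val : ℤ) * (u.2.val : ℤ))) •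
    (clockOp p ^ u.1.val * shiftOp p ^ u.2.val)

/-- Heisenberg--Weyl operators; tensor products of those of the factors on a composite system. -/
def heisenbergWeyl : (A : QSystem) → A.Phase → Op A
  | .unit, _ => (1 : Matrix Unit Unit ℂ)
  | .prime p hp _, u => haveI : NeZero p := ⟨hp.ne_zero⟩; primeHW p u
  | .tensor A B, u => heisenbergWeyl A u.1 ⊗ₖ heisenbergWeyl B u.2

/-- `A_0 = (1/d) ∑_u T_u`. -/
def phasePointZero (A : QSystem) : Op A :=
  (A.dim : ℂ)⁻¹ • ∑ u : A.Phase, heisenbergWeyl A u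

/-- The phase-space point operator `A_u = T_u A_0 T_u†`. -/
def phasePoint (A : QSystem) (u : A.Phase) : Op A :=
  heisenbergWeyl A u * phasePointZero A * (heisenbergWeyl A u).conjTranspose

/-- The discrete Wigner function `W_X(u) = (1/d) tr (A_u X)` (real when `X` is Hermitian). -/
def wigner (A : QSystem) (X : Op A) (u : A.Phase) : ℂ :=
  (A.dim : ℂ)⁻¹ * (phasePoint A u * X).trace

/-- The Wigner trace norm `‖V‖_{W,1} = ∑_u |W_V(u)|`. -/
def wignerTraceNorm (A : QSystem) (V : Op A) : ℝ :=
  ∑ u : A.Phase, ‖wigner A V u‖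

/-! ### States, channels, completely positive maps -/

section Maps

variable {α β γ δ : Type}

/-- The map `X ↦ |r⟩⟨s| ⊗ X`. -/
def blockEmbed {ι : Type} [DecidableEq ι] (r s : ι) :
    Matrix α α ℂ →ₗ[ℂ] Matrix (ι × α) (ι × α) ℂ where
  toFun X := Matrix.single r s 1 ⊗ₖ X
  map_add' X Y := Matrix.kronecker_add _ X Y
  map_smul' c X := Matrix.kronecker_smul c _ X

/-- The map `Y ↦ (⟨r| ⊗ 1) Y (|s⟩ ⊗ 1)`, i.e. the block of `Y` at position `(r, s)`. -/
def blockProj {ι : Type} (r s : ι) :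
    Matrix (ι × α) (ι × α) ℂ →ₗ[ℂ] Matrix α α ℂ where
  toFun Y := Y.submatrix (fun a => (r, a)) (fun a => (s, a))
  map_add' X Y := by ext; simp
  map_smul' c X := by ext; simp

/-- The map `id_R ⊗ Φ`. -/
def ampliation (ι : Type) [Fintype ι] [DecidableEq ι]
    (Φ : Matrix α α ℂ →ₗ[ℂ] Matrix β β ℂ) :
    Matrix (ι × α) (ι × α) ℂ →ₗ[ℂ] Matrix (ι × β) (ι × β) ℂ :=
  ∑ r : ι, ∑ s : ι, blockEmbed r s ∘ₗ Φ ∘ₗ blockProj r s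

/-- The supermap `id_R ⊗ Ξ`: a map `N` from `RA` to `RB` is expanded as
`N = ∑ (|t⟩⟨u| · ⟨r| _ |s⟩) ⊗ N_{rstu}`, and `Ξ` is applied to each `N_{rstu}`. -/
def superAmpliation (ι : Type) [Fintype ι] [DecidableEq ι]
    (Ξ : (Matrix α α ℂ →ₗ[ℂ] Matrix β β ℂ) →ₗ[ℂ] (Matrix γ γ ℂ →ₗ[ℂ] Matrix δ δ ℂ))
    (N : Matrix (ι × α) (ι × α) ℂ →ₗ[ℂ] Matrix (ι × β) (ι × β) ℂ) :
    Matrix (ι × γ) (ι × γ) ℂ →ₗ[ℂ] Matrix (ι × δ) (ι × δ) ℂ :=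
  ∑ r : ι, ∑ s : ι, ∑ t : ι, ∑ u : ι,
    blockEmbed t u ∘ₗ Ξ (blockProj t u ∘ₗ N ∘ₗ blockEmbed r s) ∘ₗ blockProj r s

/-- `id ⊗ Φ` preserves positive semi-definiteness for every finite-dimensional reference. -/
def IsCompletelyPositive (Φ : Matrix α α ℂ →ₗ[ℂ] Matrix β β ℂ) : Prop :=
  ∀ (n : ℕ) (X : Matrix (Fin n × α) (Fin n × α) ℂ),
    X.PosSemidef → (ampliation (Fin n) Φ X).PosSemidef

/-- A quantum channel: a completely positive trace-preserving linear map. -/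
def IsChannel [Fintype α] [Fintype β] (Φ : Matrix α α ℂ →ₗ[ℂ] Matrix β β ℂ) : Prop :=
  IsCompletelyPositive Φ ∧ ∀ X, (Φ X).trace = X.trace

/-- A density operator. -/
def IsState [Fintype α] (ρ : Matrix α α ℂ) : Prop := ρ.PosSemidef ∧ ρ.trace = 1

end Maps

/-! ### CPWP channels and CPWP superchannels -/

/-- The set `𝒲₊` of states with non-negative discrete Wigner function. -/
def wignerPolytope (A : QSystem) : Set (Op A) :=
  {ρ | IsState ρ ∧ ∀ u, 0 ≤ wigner A ρ u}

/-- A linear map is completely positive-Wigner-preserving if it preserves Hermiticity and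
`id_R ⊗ Φ` maps `𝒲₊` to `𝒲₊` for every system `R`. -/
def IsCPWP {A B : QSystem} (Φ : Op A →ₗ[ℂ] Op B) : Prop :=
  (∀ X : Op A, X.IsHermitian → (Φ X).IsHermitian) ∧
  ∀ (R : QSystem) (ρ : Op (R.tensor A)), ρ ∈ wignerPolytope (R.tensor A) →
    (ampliation R.Basis Φ ρ : Op (R.tensor B)) ∈ wignerPolytope (R.tensor B)

/-- `id_R ⊗ Ξ` on linear maps from `RA` to `RB`. -/
def idTensor (R : QSystem) {A B C D : QSystem}
    (Ξ : (Op A →ₗ[ℂ] Op B) →ₗ[ℂ] (Op C →ₗ[ℂ] Op D))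
    (N : Op (R.tensor A) →ₗ[ℂ] Op (R.tensor B)) : Op (R.tensor C) →ₗ[ℂ] Op (R.tensor D) :=
  superAmpliation R.Basis Ξ N

/-- A superchannel: a linear supermap such that `id_R ⊗ Ξ` maps bipartite channels to channels, for
every reference system `R`. -/
def IsSuperchannel {A B C D : QSystem}
    (Ξ : (Op A →ₗ[ℂ] Op B) →ₗ[ℂ] (Op C →ₗ[ℂ] Op D)) : Prop :=
  ∀ (R : QSystem) (N : Op (R.tensor A) →ₗ[ℂ] Op (R.tensor B)),
    IsChannel N → IsChannel (idTensor R Ξ N)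

/-- A CPWP superchannel: a superchannel such that `id_R ⊗ Ξ` maps CPWP channels to CPWP channels,
for every reference system `R`. -/
def IsCPWPSuperchannel {A B C D : QSystem}
    (Ξ : (Op A →ₗ[ℂ] Op B) →ₗ[ℂ] (Op C →ₗ[ℂ] Op D)) : Prop :=
  IsSuperchannel Ξ ∧
  ∀ (R : QSystem) (N : Op (R.tensor A) →ₗ[ℂ] Op (R.tensor B)),
    IsChannel N → IsCPWP N → IsCPWP (idTensor R Ξ N)

/-! ### Mana, generalized divergences and generalized thauma -/

/-- The mana `log max_u ‖Φ(A_u)‖_{W,1}`, with `log 0 = -∞`. -/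
def mana {A B : QSystem} (Φ : Op A →ₗ[ℂ] Op B) : EReal :=
  ENNReal.log (⨆ u : A.Phase, ENNReal.ofReal (wignerTraceNorm B (Φ (phasePoint A u))))

/-- An extended-real function `D(ρ‖σ)` of a state `ρ` and a positive semi-definite operator `σ` on
the same (arbitrary) system that obeys data processing. The values of `D` at other arguments play
no role. -/
def IsGeneralizedDivergence (D : (A : QSystem) → Op A → Op A → EReal) : Prop :=
  ∀ (A B : QSystem) (Φ : Op A →ₗ[ℂ] Op B), IsChannel Φ →
    ∀ ρ σ : Op A, IsState ρ → σ.PosSemidef → D B (Φ ρ) (Φ σ) ≤ D A ρ σ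

/-- The generalized channel divergence `D(N‖P) = sup_ψ D(N(ψ_RA)‖P(ψ_RA))`, over pure states `ψ_RA`
with `R` a copy of `A`. -/
def channelDivergence (D : (A : QSystem) → Op A → Op A → EReal) {A B : QSystem}
    (N P : Op A →ₗ[ℂ] Op B) : EReal :=
  ⨆ ψ : {ψ : A.Basis × A.Basis → ℂ // ∑ i, ‖ψ i‖ ^ 2 = 1},
    D (A.tensor B) (ampliation A.Basis N (Matrix.vecMulVec ψ.1 (star ψ.1)))
      (ampliation A.Basis P (Matrix.vecMulVec ψ.1 (star ψ.1)))

/-- The generalized thauma: the infimum of `D(N‖E)` over completely positive maps `E` with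
non-positive mana. -/
def thauma (D : (A : QSystem) → Op A → Op A → EReal) {A B : QSystem}
    (N : Op A →ₗ[ℂ] Op B) : EReal :=
  ⨅ E : {E : Op A →ₗ[ℂ] Op B // IsCompletelyPositive E ∧ mana E ≤ 0},
    channelDivergence D N E.1

end

noncomputable section

open QSystem (Op)

/-! ### Phase-space point operators -/

/-! It suffices to send each map `E` feasible for `N` to `Ξ E`, which must be feasible for `Ξ N`
with no larger divergence. There are three points.

Complete positivity. Applying `id ⊗ Ξ` to one fixed channel, which sends the input into the
reference and outputs half of a maximally entangled pair, displays all values of `Ξ` at once. Hence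
the Choi map `superChoi Ξ` is completely positive, and so is `Ξ E`.

Mana. That fixed channel is also CPWP, so the Wigner kernel of `Ξ` is non-negative
(`IsCPWPSuperchannel.wigner_nonneg`). A superchannel kills the trace of every map that annihilates
traces (`IsSuperchannel.trace_eq_zero`). Summed over its final output point, the kernel therefore
depends only on the point fed into `E`, and these sums form a probability distribution. By the
triangle inequality, the Wigner trace norm of `Ξ E` at a point operator is at most an average of
those of `E`.

Divergence. For a fixed pure input `ψ`, the map taking the Choi matrix of `M` to `(id ⊗ Ξ M)(ψ)` is
completely positive, and its trace is governed by a state `σ`. Pulling out `√σ` writes it as a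
channel applied to `(id ⊗ M)(φ)`, where `φ` is the vector of entries of `√σ`
(`IsSuperchannel.exists_channel`). Neither `φ` nor the channel depends on `M`, so data processing
applies to `N` and `E` together. -/

instance QSystem.instNonemptyBasis : (A : QSystem) → Nonempty A.Basis
  | .unit => ⟨()⟩
  | .prime _ _ _ => ⟨(0 : ZMod _)⟩
  | .tensor A B => ⟨((instNonemptyBasis A).some, (instNonemptyBasis B).some)⟩

theorem QSystem.dim_pos (A : QSystem) : 0 < A.dim := Fintype.card_pos

theorem QSystem.dim_ne_zero (A : QSystem) : (A.dim : ℂ) ≠ 0 :=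
  Nat.cast_ne_zero.2 A.dim_pos.ne'

theorem QSystem.dim_tensor (A B : QSystem) : (A.tensor B).dim = A.dim * B.dim :=
  Fintype.card_prod _ _

/-- The reflection of phase space that corresponds to transposition of operators. -/
def QSystem.reflect : (A : QSystem) → A.Phase → A.Phase
  | .unit, u => u
  | .prime _ _ _, u => (-u.1, u.2)
  | .tensor A B, u => (A.reflect u.1, B.reflect u.2)

/-! ### Characters of `ℤ_p` and Heisenberg–Weyl matrix entries for odd `p` -/

section Prime

theorem ZMod.two_mul_half {p : ℕ} (hodd : Odd p) : (2 : ZMod p) * ((p + 1) / 2 : ℕ) = 1 := by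
  obtain ⟨k, hk⟩ := hodd
  have h2 : (p + 1) / 2 = k + 1 := by omega
  have : ((2 * k + 1 : ℕ) : ZMod p) = 0 := by rw [← hk]; simp
  rw [h2]
  push_cast at this ⊢
  linear_combination this

theorem ZMod.two_mul_cancel {p : ℕ} (hodd : Odd p) {x y : ZMod p} (h : 2 * x = 2 * y) :
    x = y := by
  have := ZMod.two_mul_half hodd
  linear_combination ((p + 1) / 2 : ℕ) * h - (x - y) * this

variable (p : ℕ) [NeZero p]

theorem clockOp_eq : clockOp p = Matrix.diagonal fun j => ZMod.stdAddChar (N := p) j := by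
  unfold clockOp
  congr 1
  funext j
  have h := ZMod.stdAddChar_coe (N := p) (j.val : ℤ)
  rw [Int.cast_natCast, ZMod.natCast_zmod_val] at h
  rw [h, ← Complex.exp_nat_mul]
  congr 1
  push_cast
  ring

theorem shiftOp_pow_apply (n : ℕ) (i j : ZMod p) :
    (shiftOp p ^ n) i j = if i = j + n then 1 else 0 := by
  induction n generalizing i j with
  | zero => simp [Matrix.one_apply]
  | succ n ih =>
    rw [pow_succ, Matrix.mul_apply]
    simp only [ih]
    rw [Finset.sum_eq_single (j + 1)]
    · simp [shiftOp, add_assoc, add_comm (1 : ZMod p)]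
    · intro b _ hb; simp [shiftOp, hb]
    · simp

/-- As `p + 1` is even, `τ = ω ^ ((p + 1) / 2)` is itself a `p`-th root of unity. All phases thus
become characters of residues mod `p`, with `(p + 1) / 2` playing the role of one half. -/
theorem tau_zpow (hodd : Odd p) (n : ℤ) :
    Complex.exp ((p + 1) * Real.pi * Complex.I / p) ^ n =
      ZMod.stdAddChar (N := p) (n * ((p + 1) / 2 : ℕ)) := by
  obtain ⟨k, hk⟩ := hodd
  have h2 : (p + 1) / 2 = k + 1 := by omega
  have h := ZMod.stdAddChar_coe (N := p) (n * (k + 1))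
  push_cast at h
  rw [h2]
  push_cast
  rw [h, ← Complex.exp_int_mul]
  congr 1
  have : (p : ℂ) = 2 * k + 1 := by exact_mod_cast hk
  rw [this]
  ring

theorem primeHW_apply (hodd : Odd p) (u : ZMod p × ZMod p) (i j : ZMod p) :
    primeHW p u i j = if i = j + u.2 then
      ZMod.stdAddChar (N := p) (u.1 * i - u.1 * u.2 * ((p + 1) / 2 : ℕ)) else 0 := by
  unfold primeHW
  rw [tau_zpow p hodd, clockOp_eq, Matrix.diagonal_pow, Matrix.smul_apply, Matrix.diagonal_mul,
    shiftOp_pow_apply]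
  simp only [ZMod.natCast_zmod_val, Pi.pow_apply, smul_eq_mul, mul_ite, mul_one, mul_zero]
  split_ifs with h
  · rw [← AddChar.map_nsmul_eq_pow, ← AddChar.map_add_eq_mul]
    congr 1
    push_cast
    simp only [ZMod.natCast_zmod_val, nsmul_eq_mul]
    ring
  · rfl

variable {p}

theorem ZMod.stdAddChar_sum (b : ZMod p) :
    ∑ x, ZMod.stdAddChar (N := p) (x * b) = if b = 0 then (p : ℂ) else 0 := by
  rw [AddChar.sum_mulShift b (ZMod.isPrimitive_stdAddChar p), ZMod.card]
  split_ifs <;> simp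

theorem ZMod.star_stdAddChar (x : ZMod p) :
    star (ZMod.stdAddChar (N := p) x) = ZMod.stdAddChar (-x) := by
  rw [AddChar.map_neg_eq_conj]
  rfl

end Prime

/-- `A_0` is the parity operator. Only the shift by `i - j` reaches the entry `(i, j)`, and the
remaining sum over `a₁` is a full character sum at `(i + j) / 2`. -/
theorem phasePointZero_prime (p : ℕ) (hp : p.Prime) (hodd : Odd p) (i j : ZMod p) :
    phasePointZero (.prime p hp hodd) i j = if i + j = 0 then 1 else 0 := by
  have : NeZero p := ⟨hp.ne_zero⟩
  have hd : ((QSystem.prime p hp hodd).dim : ℂ) = p := by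
    exact_mod_cast ZMod.card p
  have hp0 : (p : ℂ) ≠ 0 := Nat.cast_ne_zero.2 hp.ne_zero
  have hh := ZMod.two_mul_half hodd
  have key : (∑ u : ZMod p × ZMod p, primeHW p u) i j = if i + j = 0 then (p : ℂ) else 0 := by
    rw [Matrix.sum_apply, Fintype.sum_prod_type_right, Finset.sum_eq_single (i - j)]
    · have e : j + (i - j) = i := by ring
      have : ∀ x : ZMod p, x * i - x * (i - j) * ((p + 1) / 2 : ℕ)
          = x * ((i + j) * ((p + 1) / 2 : ℕ)) := by
        intro x; linear_combination (-x * i) * hh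
      simp only [primeHW_apply p hodd, e, if_true, this]
      rw [ZMod.stdAddChar_sum]
      congr 1
      rw [eq_iff_iff]
      constructor
      · intro h; linear_combination 2 * h - (i + j) * hh
      · intro h; rw [h, zero_mul]
    · intro b _ hb
      simp only [primeHW_apply p hodd]
      refine Finset.sum_eq_zero fun x _ => if_neg fun h => hb ?_
      rw [h]; ring
    · simp
  unfold phasePointZero
  rw [Matrix.smul_apply, hd]
  refine (congrArg (fun z => (p : ℂ)⁻¹ • z) key).trans ?_
  split_ifs <;> simp [hp0]

/-- Conjugation by `T_u` moves the centre of the parity operator to `u.2` and adds a phase. The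
later facts about a prime factor are read off from this formula. -/
theorem phasePoint_prime (p : ℕ) [NeZero p] (hp : p.Prime) (hodd : Odd p) (u : ZMod p × ZMod p)
    (i j : ZMod p) :
    phasePoint (.prime p hp hodd) u i j =
      if i + j = 2 * u.2 then ZMod.stdAddChar (N := p) (u.1 * (i - j)) else 0 := by
  have h0 : phasePointZero (.prime p hp hodd) =
      (Matrix.of fun i j : ZMod p => if i + j = 0 then (1 : ℂ) else 0) := by
    ext i j; exact phasePointZero_prime p hp hodd i j
  have key : (primeHW p u * (Matrix.of fun i j : ZMod p => if i + j = 0 then (1 : ℂ) else 0) *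
      (primeHW p u).conjTranspose) i j =
      if i + j = 2 * u.2 then ZMod.stdAddChar (N := p) (u.1 * (i - j)) else 0 := by
    rw [Matrix.mul_apply, Finset.sum_eq_single (j - u.2)]
    · rw [Matrix.mul_apply, Finset.sum_eq_single (i - u.2)]
      · have e1 : i - u.2 + u.2 = i := by ring
        have e2 : j - u.2 + u.2 = j := by ring
        simp only [primeHW_apply p hodd, Matrix.conjTranspose_apply, Matrix.of_apply, e1, e2,
          if_true, ZMod.star_stdAddChar]
        have : (i - u.2 + (j - u.2) = 0) = (i + j = 2 * u.2) := by
          rw [eq_iff_iff]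
          constructor <;> intro h <;> linear_combination h
        simp only [this, mul_ite, ite_mul, mul_one, mul_zero, zero_mul,
          ← AddChar.map_add_eq_mul]
        congr 2
        ring
      · intro b _ hb
        rw [primeHW_apply p hodd, if_neg, zero_mul]
        intro h; exact hb (by rw [h]; ring)
      · simp
    · intro b _ hb
      rw [Matrix.conjTranspose_apply, primeHW_apply p hodd, if_neg, star_zero, mul_zero]
      intro h; exact hb (by rw [h]; ring)
    · simp
  unfold phasePoint
  rw [h0]
  exact key

theorem Matrix.sum_kronecker_sum {ι κ m n : Type*} [Fintype ι] [Fintype κ]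
    (f : ι → Matrix m m ℂ) (g : κ → Matrix n n ℂ) :
    (∑ i, f i) ⊗ₖ (∑ j, g j) = ∑ i, ∑ j, f i ⊗ₖ g j := by
  ext
  simp [Matrix.sum_apply, Finset.sum_mul_sum]

theorem phasePointZero_tensor (A B : QSystem) :
    phasePointZero (A.tensor B) = phasePointZero A ⊗ₖ phasePointZero B := by
  unfold phasePointZero
  rw [QSystem.dim_tensor, Matrix.smul_kronecker, Matrix.kronecker_smul, smul_smul]
  push_cast
  rw [mul_inv]
  congr 1
  rw [Matrix.sum_kronecker_sum]
  exact Fintype.sum_prod_type _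

theorem phasePoint_tensor (A B : QSystem) (u : A.Phase) (v : B.Phase) :
    phasePoint (A.tensor B) (u, v) = phasePoint A u ⊗ₖ phasePoint B v := by
  unfold phasePoint
  rw [phasePointZero_tensor, Matrix.mul_kronecker_mul, Matrix.mul_kronecker_mul]
  congr 1
  exact Matrix.conjTranspose_kronecker _ _

theorem phasePoint_unit (u : Unit) : phasePoint .unit u = 1 := by
  have h0 : phasePointZero .unit = 1 := by
    unfold phasePointZero
    have : QSystem.unit.dim = 1 := rfl
    rw [this]
    ext i j
    simp [heisenbergWeyl]
  unfold phasePoint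
  rw [h0]
  simp [heisenbergWeyl]

theorem phasePoint_isHermitian : ∀ (A : QSystem) (u : A.Phase), (phasePoint A u).IsHermitian
  | .unit, u => by rw [phasePoint_unit]; exact Matrix.isHermitian_one
  | .prime p hp hodd, u => by
    have : NeZero p := ⟨hp.ne_zero⟩
    ext i j
    rw [Matrix.conjTranspose_apply, phasePoint_prime, phasePoint_prime, add_comm, apply_ite star,
      star_zero, ZMod.star_stdAddChar]
    congr 2
    ring
  | .tensor A B, (u, v) => by
    rw [phasePoint_tensor]
    refine (Matrix.conjTranspose_kronecker _ _).trans ?_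
    rw [phasePoint_isHermitian A u, phasePoint_isHermitian B v]

theorem phasePoint_reflect : ∀ (A : QSystem) (u : A.Phase),
    phasePoint A (A.reflect u) = (phasePoint A u).transpose
  | .unit, u => by rw [phasePoint_unit, Matrix.transpose_one]
  | .prime p hp hodd, u => by
    have : NeZero p := ⟨hp.ne_zero⟩
    ext i j
    rw [Matrix.transpose_apply, phasePoint_prime, phasePoint_prime, add_comm]
    simp only [QSystem.reflect]
    congr 2
    ring_nf
  | .tensor A B, (u, v) => by
    refine (phasePoint_tensor A B _ _).trans ?_
    rw [phasePoint_reflect A u, phasePoint_reflect B v, phasePoint_tensor]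
    rfl

theorem trace_phasePoint : ∀ (A : QSystem) (u : A.Phase), (phasePoint A u).trace = 1
  | .unit, u => by simp [phasePoint_unit, Matrix.trace]
  | .prime p hp hodd, u => by
    have : NeZero p := ⟨hp.ne_zero⟩
    refine (Finset.sum_eq_single (u.2 : ZMod p) ?_ (by simp)).trans ?_
    · intro b _ hb
      rw [Matrix.diag_apply, phasePoint_prime, if_neg]
      intro h
      exact hb (ZMod.two_mul_cancel hodd (by linear_combination h))
    · rw [Matrix.diag_apply, phasePoint_prime, if_pos (by ring), sub_self, mul_zero,
        AddChar.map_zero_eq_one]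
  | .tensor A B, (u, v) => by
    rw [phasePoint_tensor]
    refine (Matrix.trace_kronecker _ _).trans ?_
    rw [trace_phasePoint A u, trace_phasePoint B v, one_mul]

/-- On a prime factor the trace is `p` if `u = v` and `0` otherwise, by a character sum. Only the
sign is needed later, and it is multiplicative over tensor factors. -/
theorem trace_phasePoint_mul_nonneg : ∀ (A : QSystem) (u v : A.Phase),
    0 ≤ (phasePoint A u * phasePoint A v).trace
  | .unit, u, v => by simp [phasePoint_unit, Matrix.trace]
  | .prime p hp hodd, u, v => by
    have : NeZero p := ⟨hp.ne_zero⟩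
    have h : (phasePoint (.prime p hp hodd) u * phasePoint (.prime p hp hodd) v).trace =
        if u.2 = v.2 then ∑ i : ZMod p, ZMod.stdAddChar (i * (2 * (u.1 - v.1))) *
          ZMod.stdAddChar (- (u.1 - v.1) * (2 * u.2)) else 0 := by
      refine Eq.trans (b := ∑ i : ZMod p, if u.2 = v.2 then ZMod.stdAddChar
        (i * (2 * (u.1 - v.1))) * ZMod.stdAddChar (- (u.1 - v.1) * (2 * u.2)) else 0) ?_ ?_
      · refine Finset.sum_congr rfl fun i _ => ?_
        rw [Matrix.diag_apply, Matrix.mul_apply]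
        refine (Finset.sum_eq_single (2 * u.2 - i : ZMod p) ?_ (by simp)).trans ?_
        · intro b _ hb
          rw [phasePoint_prime, if_neg, zero_mul]
          intro h; exact hb (by linear_combination h)
        · rw [phasePoint_prime, phasePoint_prime, if_pos (by ring)]
          have : (2 * u.2 - i + i = 2 * v.2) = (u.2 = v.2) := by
            rw [eq_iff_iff]
            constructor
            · intro h; exact ZMod.two_mul_cancel hodd (by linear_combination h)
            · intro h; rw [h]; ring
          simp only [this, mul_ite, mul_zero, ← AddChar.map_add_eq_mul]
          congr 2
          ring
      · split_ifs <;> simp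
    rw [h]
    split_ifs
    · rw [← Finset.sum_mul, ZMod.stdAddChar_sum]
      split_ifs with h2
      · have : u.1 - v.1 = 0 := ZMod.two_mul_cancel hodd (by rw [h2, mul_zero])
        rw [this]
        simp
      · simp
    · exact le_rfl
  | .tensor A B, (u, u'), (v, v') => by
    rw [phasePoint_tensor, phasePoint_tensor]
    refine le_of_le_of_eq ?_ (congrArg Matrix.trace (Matrix.mul_kronecker_mul _ _ _ _))
    refine le_of_le_of_eq ?_ (Matrix.trace_kronecker _ _).symm
    exact mul_nonneg (trace_phasePoint_mul_nonneg A u v) (trace_phasePoint_mul_nonneg B u' v')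

/-- The phase-space point operators form a tight frame of the space of operators. -/
theorem sum_phasePoint_mul_phasePoint : ∀ (A : QSystem) (i j k l : A.Basis),
    ∑ u, phasePoint A u l k * phasePoint A u i j = if k = i ∧ l = j then (A.dim : ℂ) else 0
  | .unit, i, j, k, l => by
    have : QSystem.unit.dim = 1 := rfl
    rw [this]
    simp [phasePoint_unit]
  | .prime p hp hodd, i, j, k, l => by
    have : NeZero p := ⟨hp.ne_zero⟩
    have hd : ((QSystem.prime p hp hodd).dim : ℂ) = p := by
      exact_mod_cast ZMod.card p
    have hh := ZMod.two_mul_half hodd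
    rw [hd]
    refine (Fintype.sum_prod_type_right _).trans ?_
    refine (Finset.sum_eq_single ((i + j) * ((p + 1) / 2 : ℕ) : ZMod p) ?_ (by simp)).trans ?_
    · intro b _ hb
      refine Finset.sum_eq_zero fun a _ => ?_
      rw [phasePoint_prime (i := i), if_neg, mul_zero]
      intro h
      apply hb
      simp only at h
      linear_combination (- b) * hh - ((p + 1) / 2 : ℕ) * h
    · simp only [phasePoint_prime]
      have h1 : i + j = 2 * ((i + j) * ((p + 1) / 2 : ℕ)) := by
        linear_combination (-(i + j)) * hh
      simp only [← h1, if_true, ite_mul, zero_mul, ← AddChar.map_add_eq_mul, ← mul_add]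
      by_cases h2 : l + k = i + j
      · simp only [h2, if_true]
        refine (ZMod.stdAddChar_sum (p := p) (l - k + (i - j))).trans ?_
        congr 1
        rw [eq_iff_iff]
        constructor
        · intro h
          constructor <;> apply ZMod.two_mul_cancel hodd
          · linear_combination h2 - h
          · linear_combination h2 + h
        · rintro ⟨rfl, rfl⟩; ring
      · simp only [h2, if_false, Finset.sum_const_zero]
        rw [if_neg]
        rintro ⟨rfl, rfl⟩
        exact h2 (add_comm _ _)
  | .tensor A B, (i, i'), (j, j'), (k, k'), (l, l') => by
    rw [QSystem.dim_tensor]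
    refine (Fintype.sum_prod_type _).trans ?_
    simp only [phasePoint_tensor, Matrix.kroneckerMap_apply]
    have h1 := sum_phasePoint_mul_phasePoint A i j k l
    have h2 := sum_phasePoint_mul_phasePoint B i' j' k' l'
    have h3 := congrArg₂ (· * ·) h1 h2
    simp only [Finset.sum_mul_sum] at h3
    calc _ = _ := Finset.sum_congr rfl fun _ _ => Finset.sum_congr rfl fun _ _ =>
              mul_mul_mul_comm _ _ _ _
      _ = _ := h3
      _ = _ := by
        simp only [Prod.mk.injEq]
        by_cases a1 : k = i <;> by_cases a2 : l = j <;> by_cases a3 : k' = i' <;>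
          by_cases a4 : l' = j' <;> simp [a1, a2, a3, a4]

theorem wigner_expansion (A : QSystem) (X : Op A) :
    ∑ u, wigner A X u • phasePoint A u = X := by
  ext i j
  have hd := A.dim_ne_zero
  simp only [Matrix.sum_apply, Matrix.smul_apply, wigner, smul_eq_mul, Matrix.trace,
    Matrix.diag_apply, Matrix.mul_apply]
  calc _ = ∑ l, ∑ k, (A.dim : ℂ)⁻¹ * X k l * ∑ u, phasePoint A u l k * phasePoint A u i j := by
        simp only [Finset.mul_sum, Finset.sum_mul]
        rw [Finset.sum_comm]
        refine Finset.sum_congr rfl fun l _ => ?_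
        rw [Finset.sum_comm]
        refine Finset.sum_congr rfl fun k _ => Finset.sum_congr rfl fun u _ => ?_
        ring
    _ = X i j := by
        simp only [sum_phasePoint_mul_phasePoint]
        rw [Finset.sum_eq_single j, Finset.sum_eq_single i]
        · simp only [and_self, if_true]
          field_simp
        · intro b _ hb; simp [hb]
        · simp
        · intro b _ hb; simp [hb]
        · simp

theorem sum_phasePoint (A : QSystem) : ∑ u, phasePoint A u = (A.dim : ℂ) • (1 : Op A) := by
  ext i j
  -- Inserting the factor `tr A_u = 1` turns the linear sum into the quadratic one of the frame
  -- identity.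
  have h : ∀ u, phasePoint A u i j = ∑ l, phasePoint A u l l * phasePoint A u i j := by
    intro u
    rw [← Finset.sum_mul]
    exact (one_mul _).symm.trans (congrArg (· * phasePoint A u i j) (trace_phasePoint A u).symm)
  rw [Matrix.sum_apply, Finset.sum_congr rfl fun u _ => h u, Finset.sum_comm]
  simp only [sum_phasePoint_mul_phasePoint]
  rw [Finset.sum_eq_single j]
  · simp [Matrix.one_apply, eq_comm]
  · intro b _ hb; simp [hb]
  · simp

theorem sum_wigner (A : QSystem) (X : Op A) : ∑ u, wigner A X u = X.trace := by
  unfold wigner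
  rw [← Finset.mul_sum, ← Matrix.trace_sum, ← Matrix.sum_mul, sum_phasePoint, Matrix.smul_mul,
    one_mul, Matrix.trace_smul, smul_eq_mul, inv_mul_cancel_left₀ A.dim_ne_zero]

/-! ### Completely positive maps -/

section CompletelyPositive

variable {α β γ ι κ : Type} [Fintype α] [Fintype β] [Fintype γ] [Fintype ι] [Fintype κ]
  [DecidableEq α] [DecidableEq β] [DecidableEq γ] [DecidableEq ι] [DecidableEq κ]

omit [Fintype α] [Fintype β] [DecidableEq α] [DecidableEq β] in
theorem ampliation_apply (Φ : Matrix α α ℂ →ₗ[ℂ] Matrix β β ℂ) (X : Matrix (ι × α) (ι × α) ℂ)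
    (p q : ι × β) :
    ampliation ι Φ X p q = Φ (blockProj p.1 q.1 X) p.2 q.2 := by
  simp only [ampliation, LinearMap.sum_apply, Matrix.sum_apply, LinearMap.comp_apply, blockEmbed,
    LinearMap.coe_mk, AddHom.coe_mk, Matrix.kroneckerMap_apply]
  rw [Finset.sum_eq_single p.1, Finset.sum_eq_single q.1]
  · simp
  · intro b _ hb; simp [hb]
  · simp
  · intro b _ hb; simp [hb]
  · simp

omit [Fintype α] [Fintype β] [DecidableEq α] [DecidableEq β] in
theorem blockProj_ampliation (Φ : Matrix α α ℂ →ₗ[ℂ] Matrix β β ℂ)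
    (X : Matrix (ι × α) (ι × α) ℂ) (r s : ι) :
    blockProj r s (ampliation ι Φ X) = Φ (blockProj r s X) := by
  ext i j
  exact ampliation_apply Φ X (r, i) (s, j)

omit [Fintype α] [Fintype β] [Fintype γ] [DecidableEq α] [DecidableEq β] [DecidableEq γ] in
theorem ampliation_comp (Ψ : Matrix β β ℂ →ₗ[ℂ] Matrix γ γ ℂ)
    (Φ : Matrix α α ℂ →ₗ[ℂ] Matrix β β ℂ) :
    ampliation ι (Ψ ∘ₗ Φ) = ampliation ι Ψ ∘ₗ ampliation ι Φ := by
  ext1 X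
  ext p q
  rw [LinearMap.comp_apply, ampliation_apply, ampliation_apply, blockProj_ampliation]
  rfl

omit [Fintype α] [Fintype β] [DecidableEq α] [DecidableEq β] in
theorem ampliation_sum {σ : Type} (s : Finset σ) (Φ : σ → Matrix α α ℂ →ₗ[ℂ] Matrix β β ℂ) :
    ampliation ι (∑ k ∈ s, Φ k) = ∑ k ∈ s, ampliation ι (Φ k) := by
  ext1 X
  ext p q
  simp only [ampliation_apply, LinearMap.sum_apply, Matrix.sum_apply]

omit [Fintype α] [Fintype β] [DecidableEq α] [DecidableEq β] in
theorem ampliation_add (Φ Ψ : Matrix α α ℂ →ₗ[ℂ] Matrix β β ℂ) :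
    ampliation ι (Φ + Ψ) = ampliation ι Φ + ampliation ι Ψ := by
  ext1 X
  ext p q
  simp only [ampliation_apply, LinearMap.add_apply, Matrix.add_apply]

omit [Fintype α] [Fintype β] [DecidableEq α] [DecidableEq β] in
theorem ampliation_smul (c : ℂ) (Φ : Matrix α α ℂ →ₗ[ℂ] Matrix β β ℂ) :
    ampliation ι (c • Φ) = c • ampliation ι Φ := by
  ext1 X
  ext p q
  simp only [ampliation_apply, LinearMap.smul_apply, Matrix.smul_apply]

omit [Fintype α] [Fintype β] [DecidableEq α] [DecidableEq β] in
theorem ampliation_kronecker (Φ : Matrix α α ℂ →ₗ[ℂ] Matrix β β ℂ) (Y : Matrix ι ι ℂ)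
    (X : Matrix α α ℂ) : ampliation ι Φ (Y ⊗ₖ X) = Y ⊗ₖ Φ X := by
  ext p q
  rw [ampliation_apply]
  have : blockProj p.1 q.1 (Y ⊗ₖ X) = Y p.1 q.1 • X := by
    ext i j; simp [blockProj]
  rw [this, map_smul]
  simp

/-- The map `X ↦ K X K†`. -/
def conjMap (K : Matrix β α ℂ) : Matrix α α ℂ →ₗ[ℂ] Matrix β β ℂ where
  toFun X := K * X * K.conjTranspose
  map_add' X Y := by rw [Matrix.mul_add, Matrix.add_mul]
  map_smul' c X := by simp

omit [Fintype β] [DecidableEq α] [DecidableEq β] in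
theorem ampliation_conjMap (K : Matrix β α ℂ) (X : Matrix (ι × α) (ι × α) ℂ) :
    ampliation ι (conjMap K) X =
      ((1 : Matrix ι ι ℂ) ⊗ₖ K) * X * ((1 : Matrix ι ι ℂ) ⊗ₖ K).conjTranspose := by
  ext p q
  rw [ampliation_apply]
  simp [conjMap, blockProj, Matrix.mul_apply, Fintype.sum_prod_type, Matrix.one_apply, ite_mul,
    Finset.sum_ite_eq, Finset.sum_mul, apply_ite]

omit [DecidableEq α] [DecidableEq β] in
theorem isCompletelyPositive_conjMap (K : Matrix β α ℂ) : IsCompletelyPositive (conjMap K) := by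
  intro n X hX
  rw [ampliation_conjMap]
  exact hX.mul_mul_conjTranspose_same _

omit [Fintype α] [Fintype β] [Fintype γ] [DecidableEq α] [DecidableEq β] [DecidableEq γ] in
theorem IsCompletelyPositive.comp {Ψ : Matrix β β ℂ →ₗ[ℂ] Matrix γ γ ℂ}
    {Φ : Matrix α α ℂ →ₗ[ℂ] Matrix β β ℂ} (hΨ : IsCompletelyPositive Ψ)
    (hΦ : IsCompletelyPositive Φ) : IsCompletelyPositive (Ψ ∘ₗ Φ) := by
  intro n X hX
  rw [ampliation_comp]
  exact hΨ n _ (hΦ n X hX)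

omit [Fintype α] [Fintype β] [DecidableEq α] [DecidableEq β] in
theorem IsCompletelyPositive.add {Ψ Φ : Matrix α α ℂ →ₗ[ℂ] Matrix β β ℂ}
    (hΨ : IsCompletelyPositive Ψ) (hΦ : IsCompletelyPositive Φ) :
    IsCompletelyPositive (Ψ + Φ) := by
  intro n X hX
  rw [ampliation_add]
  exact (hΨ n X hX).add (hΦ n X hX)

omit [Fintype α] [Fintype β] [DecidableEq α] [DecidableEq β] in
theorem IsCompletelyPositive.smul {Φ : Matrix α α ℂ →ₗ[ℂ] Matrix β β ℂ}
    (hΦ : IsCompletelyPositive Φ) {c : ℂ} (hc : 0 ≤ c) : IsCompletelyPositive (c • Φ) := by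
  intro n X hX
  rw [ampliation_smul]
  exact (hΦ n X hX).smul hc

omit [Fintype α] [Fintype β] [DecidableEq α] [DecidableEq β] in
theorem IsCompletelyPositive.sum {σ : Type} (s : Finset σ)
    {Φ : σ → Matrix α α ℂ →ₗ[ℂ] Matrix β β ℂ} (hΦ : ∀ k ∈ s, IsCompletelyPositive (Φ k)) :
    IsCompletelyPositive (∑ k ∈ s, Φ k) := by
  intro n X hX
  rw [ampliation_sum, LinearMap.sum_apply]
  exact Matrix.posSemidef_sum s fun k hk => hΦ k hk n X hX

omit [Fintype α] [Fintype β] [DecidableEq α] [DecidableEq β] in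
-- Relabelling the reference passes from the `Fin n` of the definition to any finite index type.
theorem IsCompletelyPositive.posSemidef_ampliation {Φ : Matrix α α ℂ →ₗ[ℂ] Matrix β β ℂ}
    (hΦ : IsCompletelyPositive Φ) {X : Matrix (ι × α) (ι × α) ℂ} (hX : X.PosSemidef) :
    (ampliation ι Φ X).PosSemidef := by
  let e := Fintype.equivFin ι
  have h := (hΦ (Fintype.card ι) _ (hX.submatrix (Prod.map e.symm id))).submatrix (Prod.map e id)
  convert h using 1
  ext p q
  rw [Matrix.submatrix_apply, ampliation_apply, ampliation_apply]
  refine congrArg (fun M => Φ M p.2 q.2) ?_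
  ext i j
  simp [blockProj]

omit [Fintype α] [Fintype β] [DecidableEq α] [DecidableEq β] in
theorem IsCompletelyPositive.posSemidef {Φ : Matrix α α ℂ →ₗ[ℂ] Matrix β β ℂ}
    (hΦ : IsCompletelyPositive Φ) {X : Matrix α α ℂ} (hX : X.PosSemidef) :
    (Φ X).PosSemidef := by
  have h := (hΦ.posSemidef_ampliation (ι := Unit)
    (hX.submatrix (Prod.snd : Unit × α → α))).submatrix (fun b => ((), b))
  convert h using 1
  ext i j
  rw [Matrix.submatrix_apply, ampliation_apply]
  rfl

/-- The Choi matrix `∑ |i⟩⟨j| ⊗ Φ(|i⟩⟨j|)`. -/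
def choi (Φ : Matrix α α ℂ →ₗ[ℂ] Matrix β β ℂ) : Matrix (α × β) (α × β) ℂ :=
  Matrix.of fun p q => Φ (Matrix.single p.1 q.1 1) p.2 q.2

omit [Fintype β] [DecidableEq β] in
theorem apply_eq_sum_choi (Φ : Matrix α α ℂ →ₗ[ℂ] Matrix β β ℂ) (X : Matrix α α ℂ) (i j : β) :
    Φ X i j = ∑ a, ∑ a', X a a' * choi Φ (a, i) (a', j) := by
  conv_lhs => rw [Matrix.matrix_eq_sum_single X]
  simp only [map_sum, Matrix.sum_apply, choi, Matrix.of_apply]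
  refine Finset.sum_congr rfl fun a _ => Finset.sum_congr rfl fun a' _ => ?_
  have : Matrix.single a a' (X a a') = X a a' • Matrix.single a a' (1 : ℂ) := by simp
  rw [this, map_smul]
  rfl

omit [Fintype β] [DecidableEq β] in
theorem IsCompletelyPositive.posSemidef_choi {Φ : Matrix α α ℂ →ₗ[ℂ] Matrix β β ℂ}
    (hΦ : IsCompletelyPositive Φ) : (choi Φ).PosSemidef := by
  -- The unnormalised maximally entangled vector.
  let v : α × α → ℂ := fun p => if p.1 = p.2 then 1 else 0
  have h := hΦ.posSemidef_ampliation (Matrix.posSemidef_vecMulVec_self_star v)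
  convert h using 1
  ext p q
  rw [ampliation_apply]
  simp only [choi, Matrix.of_apply]
  refine congrArg (fun M => Φ M p.2 q.2) ?_
  ext i j
  simp only [Matrix.single_apply, blockProj, LinearMap.coe_mk, AddHom.coe_mk,
    Matrix.submatrix_apply, Matrix.vecMulVec_apply, v, Pi.star_apply]
  by_cases h1 : p.1 = i <;> by_cases h2 : q.1 = j <;> simp [h1, h2]

open scoped MatrixOrder in
theorem Matrix.PosSemidef.exists_eq_conjTranspose_mul_self {M : Matrix α α ℂ}
    (hM : M.PosSemidef) : ∃ B : Matrix α α ℂ, M = B.conjTranspose * B := by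
  obtain ⟨B, hB⟩ := CStarAlgebra.nonneg_iff_eq_star_mul_self.1
    (Matrix.nonneg_iff_posSemidef.2 hM)
  exact ⟨B, hB⟩

/-- Writing the Choi matrix as `B† B` splits it into rank-one terms, one for each row of `B`. Each
row, conjugated and reshaped, is a Kraus operator. -/
theorem exists_kraus {Φ : Matrix α α ℂ →ₗ[ℂ] Matrix β β ℂ} (h : (choi Φ).PosSemidef) :
    ∃ K : α × β → Matrix β α ℂ, Φ = ∑ k, conjMap (K k) := by
  obtain ⟨B, hB⟩ := h.exists_eq_conjTranspose_mul_self
  refine ⟨fun k => Matrix.of fun b a => star (B k (a, b)), ?_⟩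
  ext1 X
  ext i j
  rw [apply_eq_sum_choi, hB]
  simp only [Matrix.mul_apply, Matrix.conjTranspose_apply, LinearMap.sum_apply, Matrix.sum_apply,
    conjMap, LinearMap.coe_mk, AddHom.coe_mk, Matrix.of_apply, star_star, Finset.mul_sum,
    Finset.sum_mul]
  rw [Finset.sum_comm]
  refine (Finset.sum_congr rfl fun a' _ => Finset.sum_comm).trans ?_
  rw [Finset.sum_comm]
  refine Finset.sum_congr rfl fun k _ => Finset.sum_congr rfl fun a' _ =>
    Finset.sum_congr rfl fun a _ => ?_
  ring

theorem isCompletelyPositive_iff_choi {Φ : Matrix α α ℂ →ₗ[ℂ] Matrix β β ℂ} :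
    IsCompletelyPositive Φ ↔ (choi Φ).PosSemidef := by
  refine ⟨fun h => h.posSemidef_choi, fun h => ?_⟩
  obtain ⟨K, rfl⟩ := exists_kraus h
  exact IsCompletelyPositive.sum _ fun k _ => isCompletelyPositive_conjMap _

theorem IsCompletelyPositive.map_conjTranspose {Φ : Matrix α α ℂ →ₗ[ℂ] Matrix β β ℂ}
    (hΦ : IsCompletelyPositive Φ) (X : Matrix α α ℂ) :
    Φ X.conjTranspose = (Φ X).conjTranspose := by
  obtain ⟨K, rfl⟩ := exists_kraus hΦ.posSemidef_choi
  simp [conjMap, LinearMap.sum_apply, Matrix.conjTranspose_sum, Matrix.mul_assoc]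

omit [DecidableEq α] [DecidableEq β] in
theorem trace_ampliation {Φ : Matrix α α ℂ →ₗ[ℂ] Matrix β β ℂ}
    (hΦ : ∀ X, (Φ X).trace = X.trace) (X : Matrix (ι × α) (ι × α) ℂ) :
    (ampliation ι Φ X).trace = X.trace := by
  have h : ∀ r, ∑ b, Φ (blockProj r r X) b b = ∑ a, X (r, a) (r, a) := fun r => hΦ _
  simp only [Matrix.trace, Matrix.diag_apply, Fintype.sum_prod_type, ampliation_apply, h]

theorem IsChannel.isChannel_ampliation {Φ : Matrix α α ℂ →ₗ[ℂ] Matrix β β ℂ} (hΦ : IsChannel Φ) :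
    IsChannel (ampliation ι Φ) := by
  obtain ⟨hcp, htr⟩ := hΦ
  obtain ⟨K, rfl⟩ := exists_kraus hcp.posSemidef_choi
  refine ⟨?_, trace_ampliation htr⟩
  rw [ampliation_sum]
  refine IsCompletelyPositive.sum _ fun k _ => ?_
  have : ampliation ι (conjMap (K k)) =
      conjMap ((1 : Matrix ι ι ℂ) ⊗ₖ K k) := by
    ext1 X; exact ampliation_conjMap _ _
  rw [this]
  exact isCompletelyPositive_conjMap _

omit [DecidableEq α] [DecidableEq β] in
theorem IsChannel.isState {Φ : Matrix α α ℂ →ₗ[ℂ] Matrix β β ℂ} (hΦ : IsChannel Φ)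
    {ρ : Matrix α α ℂ} (hρ : IsState ρ) : IsState (Φ ρ) :=
  ⟨hΦ.1.posSemidef hρ.1, (hΦ.2 ρ).trans hρ.2⟩

end CompletelyPositive

/-! ### Spectral calculus of positive semi-definite matrices -/

section Spectral

variable {α : Type} [Fintype α] [DecidableEq α]

/-- A positive semi-definite matrix has a Hermitian square root with a Hermitian pseudo-inverse;
`Q` is the projection on the kernel. -/
theorem Matrix.PosSemidef.exists_sqrt_pinv {σ : Matrix α α ℂ} (hσ : σ.PosSemidef) :
    ∃ S T Q : Matrix α α ℂ, S.IsHermitian ∧ T.IsHermitian ∧ Q.IsHermitian ∧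
      S * S = σ ∧ T * S = 1 - Q ∧ S * T = 1 - Q ∧ Q * S = 0 ∧ S * Q = 0 ∧ Q * Q = Q := by
  let U : Matrix α α ℂ := hσ.1.eigenvectorUnitary
  have hU : U.conjTranspose * U = 1 := Unitary.coe_star_mul_self hσ.1.eigenvectorUnitary
  have hU' : U * U.conjTranspose = 1 := Unitary.coe_mul_star_self hσ.1.eigenvectorUnitary
  let f : (α → ℝ) → Matrix α α ℂ := fun d => U * Matrix.diagonal (fun i => (d i : ℂ)) *
    U.conjTranspose
  have hf : ∀ d, (f d).IsHermitian := by
    intro d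
    simp only [f, Matrix.IsHermitian, Matrix.conjTranspose_mul, Matrix.conjTranspose_conjTranspose,
      Matrix.diagonal_conjTranspose, Matrix.mul_assoc]
    congr 3
    ext i
    simp
  have hmul : ∀ d d', f d * f d' = f (d * d') := by
    intro d d'
    calc f d * f d' = U * Matrix.diagonal (fun i => (d i : ℂ)) * (U.conjTranspose * U) *
          Matrix.diagonal (fun i => (d' i : ℂ)) * U.conjTranspose := by
          simp only [f, Matrix.mul_assoc]
      _ = _ := by
          rw [hU, Matrix.mul_one, Matrix.mul_assoc U, Matrix.diagonal_mul_diagonal]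
          simp [f]
  have hone : f 1 = 1 := by simp [f, hU']
  have hzero : f 0 = 0 := by simp [f]
  have hsub : ∀ d d', f (d - d') = f d - f d' := by
    intro d d'
    simp only [f, ← Matrix.sub_mul, ← Matrix.mul_sub, Matrix.diagonal_sub]
    simp
  have hσf : f hσ.1.eigenvalues = σ := by
    conv_rhs => rw [hσ.1.spectral_theorem]
    rfl
  let s : α → ℝ := fun i => √(hσ.1.eigenvalues i)
  have hs : s * s = hσ.1.eigenvalues := by
    funext i; exact Real.mul_self_sqrt (hσ.eigenvalues_nonneg i)
  let q : α → ℝ := fun i => if s i = 0 then 1 else 0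
  -- Since `f` is multiplicative, every identity reduces to one between eigenvalues. The convention
  -- `0⁻¹ = 0` makes `f s⁻¹` the pseudo-inverse.
  refine ⟨f s, f s⁻¹, f q, hf _, hf _, hf _, ?_, ?_, ?_, ?_, ?_, ?_⟩
  · rw [hmul, hs, hσf]
  all_goals rw [hmul]; try rw [← hone, ← hsub]
  all_goals try rw [← hzero]
  all_goals
    congr 1
    funext i
    by_cases h : s i = 0 <;> simp [q, h]

/-- A Hermitian matrix becomes positive semi-definite after adding a multiple of the identity. -/
theorem Matrix.IsHermitian.exists_posSemidef_one_add {Y : Matrix α α ℂ} (hY : Y.IsHermitian) :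
    ∃ c : ℝ, 0 < c ∧ ((c : ℂ) • (1 : Matrix α α ℂ) + Y).PosSemidef := by
  obtain ⟨c, hc0, hc⟩ : ∃ c : ℝ, 0 < c ∧ ∀ i, 0 ≤ c + hY.eigenvalues i := by
    -- The sum dominates each `-λ_i`; the `1` makes the constant strictly positive.
    refine ⟨1 + ∑ i, |hY.eigenvalues i|, by positivity, fun i => ?_⟩
    have := Finset.single_le_sum (f := fun i => |hY.eigenvalues i|)
      (fun i _ => abs_nonneg _) (Finset.mem_univ i)
    have := neg_abs_le (hY.eigenvalues i)
    linarith
  refine ⟨c, hc0, ?_⟩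
  let U : Matrix α α ℂ := hY.eigenvectorUnitary
  have hU' : U * U.conjTranspose = 1 := Unitary.coe_mul_star_self hY.eigenvectorUnitary
  have h : (c : ℂ) • (1 : Matrix α α ℂ) + Y =
      U * Matrix.diagonal (fun i => ((c + hY.eigenvalues i : ℝ) : ℂ)) * U.conjTranspose := by
    conv_lhs => rw [hY.spectral_theorem]
    have : Matrix.diagonal (fun i => ((c + hY.eigenvalues i : ℝ) : ℂ)) =
        (c : ℂ) • (1 : Matrix α α ℂ) + Matrix.diagonal (fun i => (hY.eigenvalues i : ℂ)) := by
      rw [← Matrix.diagonal_one, ← Matrix.diagonal_smul, Matrix.diagonal_add]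
      congr 1
      funext i
      simp
    rw [this, Matrix.mul_add, Matrix.add_mul, Matrix.mul_smul, Matrix.smul_mul, Matrix.mul_one, hU']
    rfl
  rw [h]
  refine Matrix.PosSemidef.mul_mul_conjTranspose_same (Matrix.PosSemidef.diagonal fun i => ?_) _
  exact Complex.zero_le_real.2 (hc i)

end Spectral

/-! ### Expansion of maps and supermaps -/

section Expansion

variable {α β γ δ ι : Type} [Fintype α] [Fintype β] [Fintype γ] [Fintype δ] [Fintype ι]
  [DecidableEq α] [DecidableEq β] [DecidableEq γ] [DecidableEq δ] [DecidableEq ι]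

/-- The map `X ↦ ⟨a|X|a'⟩ |b⟩⟨b'|`, for `q = (a, b)` and `q' = (a', b')`. -/
def unitMap (q q' : α × β) : Matrix α α ℂ →ₗ[ℂ] Matrix β β ℂ where
  toFun X := X q.1 q'.1 • Matrix.single q.2 q'.2 1
  map_add' X Y := by rw [Matrix.add_apply, add_smul]
  map_smul' c X := by rw [Matrix.smul_apply, smul_assoc]; rfl

theorem sum_choi_smul_unitMap (M : Matrix α α ℂ →ₗ[ℂ] Matrix β β ℂ) :
    ∑ q, ∑ q', choi M q q' • unitMap q q' = M := by
  ext1 X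
  ext i j
  rw [apply_eq_sum_choi M]
  simp only [LinearMap.sum_apply, Matrix.sum_apply, LinearMap.smul_apply, Matrix.smul_apply,
    unitMap, LinearMap.coe_mk, AddHom.coe_mk, smul_eq_mul, Fintype.sum_prod_type,
    Matrix.single_apply]
  refine Finset.sum_congr rfl fun a _ => ?_
  rw [Finset.sum_eq_single i]
  · refine Finset.sum_congr rfl fun a' _ => ?_
    rw [Finset.sum_eq_single j]
    · simp [mul_comm]
    · intro b _ hb; simp [hb]
    · simp
  · intro b _ hb; simp [hb]
  · simp

/-- The map `X ↦ tr (P X) Y`. -/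
def measurePrepare (P : Matrix α α ℂ) (Y : Matrix β β ℂ) :
    Matrix α α ℂ →ₗ[ℂ] Matrix β β ℂ where
  toFun X := (P * X).trace • Y
  map_add' X X' := by rw [Matrix.mul_add, Matrix.trace_add, add_smul]
  map_smul' c X := by rw [Matrix.mul_smul, Matrix.trace_smul, smul_assoc]; rfl

omit [Fintype β] [DecidableEq α] [DecidableEq β] in
theorem measurePrepare_apply (P : Matrix α α ℂ) (Y : Matrix β β ℂ) (X : Matrix α α ℂ) :
    measurePrepare P Y X = (P * X).trace • Y := rfl

omit [Fintype β] [DecidableEq β] in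
theorem choi_measurePrepare (P : Matrix α α ℂ) (Y : Matrix β β ℂ) :
    choi (measurePrepare P Y) = P.transpose ⊗ₖ Y := by
  ext p q
  simp [choi, measurePrepare_apply, Matrix.trace_mul_single]

variable (Ξ : (Matrix α α ℂ →ₗ[ℂ] Matrix β β ℂ) →ₗ[ℂ] (Matrix γ γ ℂ →ₗ[ℂ] Matrix δ δ ℂ))

/-- The map `W ↦ ∑ |q⟩⟨q'| ⊗ Ξ(E_{qq'})(W)`, where `E_{qq'}` are the unit maps. -/
def superChoi : Matrix γ γ ℂ →ₗ[ℂ] Matrix ((α × β) × δ) ((α × β) × δ) ℂ where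
  toFun W := Matrix.of fun p p' => Ξ (unitMap p.1 p'.1) W p.2 p'.2
  map_add' X Y := by ext; simp
  map_smul' c X := by ext; simp

omit [Fintype γ] [Fintype δ] [DecidableEq γ] [DecidableEq δ] in
theorem superMap_eq_sum (M : Matrix α α ℂ →ₗ[ℂ] Matrix β β ℂ) (W : Matrix γ γ ℂ) (d d' : δ) :
    Ξ M W d d' = ∑ q, ∑ q', choi M q q' * superChoi Ξ W (q, d) (q', d') := by
  conv_lhs => rw [← sum_choi_smul_unitMap M]
  simp only [map_sum, map_smul, LinearMap.sum_apply, Matrix.sum_apply, LinearMap.smul_apply,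
    Matrix.smul_apply, smul_eq_mul]
  rfl

omit [Fintype γ] [DecidableEq γ] [DecidableEq δ] in
-- The trace pairing contracts the Choi map with the transpose of `P ⊗ Q`, which is the Choi matrix
-- of `measurePrepare P Q.transpose`. This converts Wigner values of the Choi map into values of
-- `Ξ`.
theorem trace_kronecker_mul_superChoi (P : Matrix α α ℂ) (Q : Matrix β β ℂ) (R : Matrix δ δ ℂ)
    (W : Matrix γ γ ℂ) :
    (((P ⊗ₖ Q) ⊗ₖ R) * superChoi Ξ W).trace = (R * Ξ (measurePrepare P Q.transpose) W).trace := by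
  simp only [Matrix.trace, Matrix.diag_apply, Matrix.mul_apply, superMap_eq_sum,
    choi_measurePrepare, Fintype.sum_prod_type (α₁ := α × β), Matrix.kroneckerMap_apply,
    Matrix.transpose_apply, Finset.mul_sum]
  rw [Finset.sum_comm]
  refine Finset.sum_congr rfl fun d _ => ?_
  rw [Finset.sum_comm' (t' := Finset.univ) (s' := fun _ => Finset.univ) (by simp)]
  rw [Finset.sum_comm]
  refine (Finset.sum_congr rfl fun q _ => Finset.sum_comm).trans ?_
  rw [Finset.sum_comm]
  refine Finset.sum_congr rfl fun d' _ => ?_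
  rw [Finset.sum_comm]
  refine Finset.sum_congr rfl fun q _ => Finset.sum_congr rfl fun q' _ => ?_
  ring

omit [Fintype α] [Fintype β] [Fintype γ] [Fintype δ] [DecidableEq α] [DecidableEq β]
  [DecidableEq γ] [DecidableEq δ] in
theorem superAmpliation_apply
    (N : Matrix (ι × α) (ι × α) ℂ →ₗ[ℂ] Matrix (ι × β) (ι × β) ℂ)
    (W : Matrix (ι × γ) (ι × γ) ℂ) (p p' : ι × δ) :
    superAmpliation ι Ξ N W p p' = ∑ r, ∑ s,
      Ξ (blockProj p.1 p'.1 ∘ₗ N ∘ₗ blockEmbed r s) (blockProj r s W) p.2 p'.2 := by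
  simp only [superAmpliation, LinearMap.sum_apply, Matrix.sum_apply]
  refine Finset.sum_congr rfl fun r _ => Finset.sum_congr rfl fun s _ => ?_
  rw [Finset.sum_eq_single p.1, Finset.sum_eq_single p'.1]
  · simp [blockEmbed]
  · intro b _ hb; simp [blockEmbed, hb]
  · simp
  · intro b _ hb; simp [blockEmbed, hb]
  · simp

omit [Fintype α] [Fintype β] [Fintype γ] [Fintype δ] [DecidableEq α] [DecidableEq β]
  [DecidableEq γ] [DecidableEq δ] in
theorem superAmpliation_smul (c : ℂ)
    (N : Matrix (ι × α) (ι × α) ℂ →ₗ[ℂ] Matrix (ι × β) (ι × β) ℂ) :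
    superAmpliation ι Ξ (c • N) = c • superAmpliation ι Ξ N := by
  simp only [superAmpliation, LinearMap.smul_comp, LinearMap.comp_smul, map_smul,
    Finset.smul_sum]

omit [Fintype α] [Fintype β] [Fintype γ] [Fintype δ] [DecidableEq α] [DecidableEq β]
  [DecidableEq γ] [DecidableEq δ] in
theorem superAmpliation_ampliation (N : Matrix α α ℂ →ₗ[ℂ] Matrix β β ℂ) :
    superAmpliation ι Ξ (ampliation ι N) = ampliation ι (Ξ N) := by
  ext1 W
  ext p p'
  rw [superAmpliation_apply, ampliation_apply]
  have h : ∀ r s, blockProj p.1 p'.1 ∘ₗ ampliation ι N ∘ₗ blockEmbed r s =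
      (Matrix.single r s (1 : ℂ) p.1 p'.1) • N := by
    intro r s
    ext1 X
    rw [LinearMap.comp_apply, LinearMap.comp_apply, blockProj_ampliation, LinearMap.smul_apply,
      ← map_smul]
    rfl
  simp only [h, map_smul, LinearMap.smul_apply, Matrix.smul_apply]
  rw [Finset.sum_eq_single p.1, Finset.sum_eq_single p'.1]
  · simp
  · intro b _ hb; simp [hb]
  · simp
  · intro b _ hb; simp [hb]
  · simp

/-- The matrix of `|r⟩⊗|a⟩ ↦ ∑_b |a⟩⊗|b⟩⊗|b⟩`, zero on the other blocks. -/
def entanglerKraus (r : ι) : Matrix ((α × β) × β) (ι × α) ℂ :=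
  Matrix.of fun q p => if p = (r, q.1.1) ∧ q.1.2 = q.2 then 1 else 0

/-- The map `Y ⊗ Z ↦ tr Y · Z ⊗ ∑_{bb'} |bb⟩⟨b'b'|`. -/
def entangler : Matrix (ι × α) (ι × α) ℂ →ₗ[ℂ] Matrix ((α × β) × β) ((α × β) × β) ℂ :=
  ∑ r : ι, conjMap (entanglerKraus r)

omit [Fintype β] in
theorem entangler_apply (X : Matrix (ι × α) (ι × α) ℂ) (q q' : (α × β) × β) :
    entangler X q q' = if q.1.2 = q.2 ∧ q'.1.2 = q'.2 then
      ∑ r, X (r, q.1.1) (r, q'.1.1) else 0 := by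
  simp only [entangler, LinearMap.sum_apply, Matrix.sum_apply, conjMap, LinearMap.coe_mk,
    AddHom.coe_mk, Matrix.mul_apply, Matrix.conjTranspose_apply, entanglerKraus, Matrix.of_apply]
  by_cases h : q.1.2 = q.2 <;> by_cases h' : q'.1.2 = q'.2 <;> simp [h, h', apply_ite]

theorem isCompletelyPositive_entangler :
    IsCompletelyPositive (entangler (α := α) (β := β) (ι := ι)) :=
  IsCompletelyPositive.sum _ fun _ _ => isCompletelyPositive_conjMap _

theorem trace_entangler (X : Matrix (ι × α) (ι × α) ℂ) :
    (entangler (β := β) X).trace = Fintype.card β * X.trace := by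
  simp only [Matrix.trace, Matrix.diag_apply, entangler_apply, and_self, Fintype.sum_prod_type]
  simp only [Finset.sum_ite_eq, Finset.mem_univ, if_true, Finset.sum_const, Finset.card_univ,
    nsmul_eq_mul, Finset.mul_sum]
  rw [Finset.sum_comm]

omit [Fintype γ] [Fintype δ] [DecidableEq γ] [DecidableEq δ] in
-- Relative to the output reference, the blocks of the entangler are exactly the unit maps. The
-- input reference is discarded, hence the partial trace of `W`.
theorem superAmpliation_entangler (W : Matrix ((α × β) × γ) ((α × β) × γ) ℂ) :
    superAmpliation (α × β) Ξ (entangler (α := α) (β := β) (ι := α × β)) W = superChoi Ξ (∑ r, blockProj r r W) := by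
  ext p p'
  rw [superAmpliation_apply]
  have h : ∀ r s, blockProj p.1 p'.1 ∘ₗ entangler (β := β) (ι := α × β) ∘ₗ blockEmbed (α := α) r s =
      (if r = s then (1 : ℂ) else 0) • unitMap p.1 p'.1 := by
    intro r s
    ext1 X
    ext i j
    simp only [LinearMap.comp_apply, blockProj, blockEmbed, LinearMap.coe_mk, AddHom.coe_mk,
      Matrix.submatrix_apply, entangler_apply, Matrix.kroneckerMap_apply, LinearMap.smul_apply,
      Matrix.smul_apply, unitMap, Matrix.single_apply, smul_eq_mul, ← Finset.sum_mul]
    have : ∑ x : α × β, (if r = x ∧ s = x then (1 : ℂ) else 0) = if r = s then 1 else 0 := by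
      rw [Finset.sum_eq_single r]
      · simp [eq_comm]
      · intro b _ hb; rw [if_neg]; rintro ⟨rfl, -⟩; exact hb rfl
      · simp
    rw [this]
    by_cases h1 : r = s <;> by_cases h2 : p.1.2 = i ∧ p'.1.2 = j <;> simp [h1, h2]
  simp only [h, map_smul, LinearMap.smul_apply, Matrix.smul_apply, smul_eq_mul, ite_mul, one_mul, zero_mul,
    Finset.sum_ite_eq, Finset.mem_univ, if_true, map_sum, Matrix.sum_apply]
  rfl

theorem isCompletelyPositive_blockEmbed (r : ι) :
    IsCompletelyPositive (blockEmbed (α := α) r r) := by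
  have : blockEmbed (α := α) r r =
      conjMap (Matrix.of fun (p : ι × α) a => if p = (r, a) then (1 : ℂ) else 0) := by
    ext1 X
    ext p q
    obtain ⟨p1, p2⟩ := p
    obtain ⟨q1, q2⟩ := q
    simp only [blockEmbed, conjMap, LinearMap.coe_mk, AddHom.coe_mk, Matrix.kroneckerMap_apply,
      Matrix.single_apply, Matrix.mul_apply, Matrix.of_apply, Matrix.conjTranspose_apply,
      Prod.mk.injEq]
    rcases eq_or_ne r p1 with rfl | h1 <;> rcases eq_or_ne r q1 with rfl | h2
    · simp [apply_ite star]
    · simp [h2, h2.symm]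
    · simp [h1, h1.symm]
    · simp [h1, h1.symm]
  rw [this]
  exact isCompletelyPositive_conjMap _

omit [Fintype γ] [DecidableEq γ] in
/-- If the supermap has a completely positive Choi map, it preserves complete positivity. -/
theorem isCompletelyPositive_superMap (hΞ : IsCompletelyPositive (superChoi Ξ))
    {E : Matrix α α ℂ →ₗ[ℂ] Matrix β β ℂ} (hE : IsCompletelyPositive E) :
    IsCompletelyPositive (Ξ E) := by
  obtain ⟨B, hB⟩ := hE.posSemidef_choi.exists_eq_conjTranspose_mul_self
  -- One term for each row of `B`, where `choi E = B† B`: the rank-one part of `choi E` from row `k`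
  -- is contracted with the Choi map.
  have : Ξ E = ∑ k, conjMap (Matrix.of fun (d : δ) (p : (α × β) × δ) =>
      if d = p.2 then star (B k p.1) else 0) ∘ₗ superChoi Ξ := by
    ext1 W
    ext d d'
    simp only [superMap_eq_sum, hB, Matrix.mul_apply, Matrix.conjTranspose_apply,
      LinearMap.sum_apply, Matrix.sum_apply, LinearMap.comp_apply, conjMap, LinearMap.coe_mk,
      AddHom.coe_mk, Matrix.of_apply, Fintype.sum_prod_type (α₁ := α × β), ite_mul, zero_mul,
      Finset.sum_ite_eq, Finset.mem_univ, if_true, apply_ite star, star_star, star_zero, mul_ite,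
      mul_zero, Finset.sum_mul]
    rw [Finset.sum_comm]
    refine (Finset.sum_congr rfl fun q _ => Finset.sum_comm).trans ?_
    rw [Finset.sum_comm]
    refine Finset.sum_congr rfl fun k _ => Finset.sum_congr rfl fun q' _ =>
      Finset.sum_congr rfl fun q _ => ?_
    ring
  rw [this]
  exact IsCompletelyPositive.sum _ fun k _ => (isCompletelyPositive_conjMap _).comp hΞ

/-- The map `X ↦ M(X†)†`. -/
def conjTransposeMap (M : Matrix α α ℂ →ₗ[ℂ] Matrix β β ℂ) :
    Matrix α α ℂ →ₗ[ℂ] Matrix β β ℂ where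
  toFun X := (M X.conjTranspose).conjTranspose
  map_add' X Y := by simp
  map_smul' c X := by simp

omit [Fintype α] [Fintype β] [DecidableEq β] in
theorem choi_conjTransposeMap (M : Matrix α α ℂ →ₗ[ℂ] Matrix β β ℂ) :
    choi (conjTransposeMap M) = (choi M).conjTranspose := by
  ext p q
  simp [choi, conjTransposeMap, Matrix.conjTranspose_apply]

omit [Fintype α] [Fintype β] [DecidableEq β] in
theorem choi_add (M M' : Matrix α α ℂ →ₗ[ℂ] Matrix β β ℂ) :
    choi (M + M') = choi M + choi M' := rfl

omit [Fintype α] [Fintype β] [DecidableEq β] in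
theorem choi_smul (c : ℂ) (M : Matrix α α ℂ →ₗ[ℂ] Matrix β β ℂ) :
    choi (c • M) = c • choi M := rfl

end Expansion

/-! ### Superchannels -/

section Superchannel

variable {A B C D : QSystem} {Ξ : (Op A →ₗ[ℂ] Op B) →ₗ[ℂ] (Op C →ₗ[ℂ] Op D)}

variable (A B) in
/-- The channel `Y ⊗ Z ↦ tr Y · Z ⊗ Φ_{BB}` with the maximally entangled state `Φ_{BB}`. -/
def entanglingChannel : Op ((A.tensor B).tensor A) →ₗ[ℂ] Op ((A.tensor B).tensor B) :=
  (B.dim : ℂ)⁻¹ • entangler (α := A.Basis) (β := B.Basis) (ι := A.Basis × B.Basis)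

theorem isChannel_entanglingChannel : IsChannel (entanglingChannel A B) := by
  refine ⟨isCompletelyPositive_entangler.smul (by positivity), fun X => ?_⟩
  refine (Matrix.trace_smul (B.dim : ℂ)⁻¹ (entangler (β := B.Basis) X)).trans ?_
  refine (congrArg (fun z : ℂ => (B.dim : ℂ)⁻¹ • z) (trace_entangler (β := B.Basis) X)).trans ?_
  exact inv_mul_cancel_left₀ B.dim_ne_zero _

theorem idTensor_entanglingChannel (W : Op ((A.tensor B).tensor C)) :
    idTensor (A.tensor B) Ξ (entanglingChannel A B) W =
      (B.dim : ℂ)⁻¹ • superChoi Ξ (∑ r : A.Basis × B.Basis, blockProj r r W) := by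
  rw [← superAmpliation_entangler]
  exact congrArg (fun M => M W) (superAmpliation_smul Ξ (B.dim : ℂ)⁻¹ entangler)

/-- Placing `W` beside a basis state `|r⟩⟨r|` makes the partial trace return `W`. The Choi map is
thus a positive multiple of a channel composed with an embedding. -/
theorem IsSuperchannel.isCompletelyPositive_superChoi (hΞ : IsSuperchannel Ξ) :
    IsCompletelyPositive (superChoi Ξ) := by
  have h := (hΞ (A.tensor B) _ isChannel_entanglingChannel).1
  let r : A.Basis × B.Basis := (A.tensor B).instNonemptyBasis.some
  have h2 : superChoi Ξ =
      (B.dim : ℂ) • (idTensor (A.tensor B) Ξ (entanglingChannel A B) ∘ₗ blockEmbed r r) := by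
    ext1 W
    rw [LinearMap.smul_apply, LinearMap.comp_apply, idTensor_entanglingChannel, smul_smul,
      mul_inv_cancel₀ B.dim_ne_zero, one_smul]
    congr 1
    rw [Finset.sum_eq_single r]
    · ext i j; simp [blockProj, blockEmbed]
    · intro b _ hb; ext i j; simp [blockProj, blockEmbed, hb.symm]
    · simp
  rw [h2]
  exact (h.comp (isCompletelyPositive_blockEmbed r)).smul (by positivity)

theorem IsSuperchannel.trace_of_isChannel (hΞ : IsSuperchannel Ξ) {N : Op A →ₗ[ℂ] Op B}
    (hN : IsChannel N) (W : Op C) : (Ξ N W).trace = W.trace := by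
  have h := (hΞ .unit (ampliation Unit N) (hN.isChannel_ampliation (ι := Unit))).2
    ((1 : Matrix Unit Unit ℂ) ⊗ₖ W)
  have h2 : idTensor .unit Ξ (ampliation Unit N) = ampliation Unit (Ξ N) :=
    superAmpliation_ampliation (ι := Unit) Ξ N
  rw [h2, ampliation_kronecker] at h
  have h3 := (Matrix.trace_kronecker (1 : Matrix Unit Unit ℂ) (Ξ N W)).symm.trans
    (h.trans (Matrix.trace_kronecker (1 : Matrix Unit Unit ℂ) W))
  simpa using h3

theorem isChannel_depolarizing :
    IsChannel ((B.dim : ℂ)⁻¹ • measurePrepare (1 : Op A) (1 : Op B)) := by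
  refine ⟨?_, fun X => ?_⟩
  · refine IsCompletelyPositive.smul ?_ (by positivity)
    rw [isCompletelyPositive_iff_choi, choi_measurePrepare, Matrix.transpose_one,
      Matrix.one_kronecker_one]
    exact Matrix.PosSemidef.one
  · have : (1 : Op B).trace = (B.dim : ℂ) := Matrix.trace_one
    rw [LinearMap.smul_apply, measurePrepare_apply, Matrix.trace_smul, Matrix.trace_smul, this,
      one_mul, smul_eq_mul, smul_eq_mul]
    field_simp [B.dim_ne_zero]

/-- The completely depolarizing channel has a Choi matrix proportional to the identity, so adding a
small multiple of `M` to it still gives a channel. `Ξ` maps both channels to trace-preserving maps,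
and the difference gives the claim. -/
theorem IsSuperchannel.trace_of_isHermitian (hΞ : IsSuperchannel Ξ) {M : Op A →ₗ[ℂ] Op B}
    (hM : ∀ X, (M X).trace = 0) (hh : (choi M).IsHermitian) (W : Op C) : (Ξ M W).trace = 0 := by
  obtain ⟨c, hc, hp⟩ := hh.exists_posSemidef_one_add
  have hc' : (c : ℂ) ≠ 0 := by exact_mod_cast hc.ne'
  let Δ : Op A →ₗ[ℂ] Op B := measurePrepare 1 1
  have h1 : IsChannel ((B.dim : ℂ)⁻¹ • Δ + ((B.dim : ℂ)⁻¹ * (c : ℂ)⁻¹) • M) := by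
    refine ⟨?_, fun X => ?_⟩
    · have : (B.dim : ℂ)⁻¹ • Δ + ((B.dim : ℂ)⁻¹ * (c : ℂ)⁻¹) • M =
          ((B.dim : ℂ)⁻¹ * (c : ℂ)⁻¹) • ((c : ℂ) • Δ + M) := by
        rw [smul_add, smul_smul, inv_mul_cancel_right₀ hc']
      rw [this]
      have hc0 : (0 : ℂ) ≤ (c : ℂ)⁻¹ := by
        rw [← Complex.ofReal_inv]; exact Complex.zero_le_real.2 (inv_nonneg.2 hc.le)
      refine IsCompletelyPositive.smul ?_ (mul_nonneg (by positivity) hc0)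
      rw [isCompletelyPositive_iff_choi, choi_add, choi_smul]
      have : choi Δ = 1 := by
        simp only [Δ]
        rw [choi_measurePrepare, Matrix.transpose_one, Matrix.one_kronecker_one]
      rw [this]
      exact hp
    · rw [LinearMap.add_apply, Matrix.trace_add, isChannel_depolarizing.2, LinearMap.smul_apply,
        Matrix.trace_smul, hM, smul_zero, add_zero]
  have h2 := hΞ.trace_of_isChannel h1 W
  rw [map_add, LinearMap.add_apply, Matrix.trace_add,
    hΞ.trace_of_isChannel isChannel_depolarizing, map_smul, LinearMap.smul_apply,
    Matrix.trace_smul, smul_eq_mul] at h2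
  have h3 := add_eq_left.1 h2
  exact (mul_eq_zero.1 h3).resolve_left
    (mul_ne_zero (inv_ne_zero B.dim_ne_zero) (inv_ne_zero hc'))

/-- Both `M + M*` and `i (M - M*)`, with `M* = conjTransposeMap M`, have Hermitian Choi matrices,
and together they recover `M`. -/
theorem IsSuperchannel.trace_eq_zero (hΞ : IsSuperchannel Ξ) {M : Op A →ₗ[ℂ] Op B}
    (hM : ∀ X, (M X).trace = 0) (W : Op C) : (Ξ M W).trace = 0 := by
  have hM' : ∀ X, (conjTransposeMap M X).trace = 0 := by
    intro X
    simp [conjTransposeMap, Matrix.trace_conjTranspose, hM]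
  have h1 := hΞ.trace_of_isHermitian (M := M + conjTransposeMap M)
    (fun X => by rw [LinearMap.add_apply, Matrix.trace_add, hM, hM', add_zero])
    (by rw [choi_add, choi_conjTransposeMap, Matrix.IsHermitian, Matrix.conjTranspose_add,
          Matrix.conjTranspose_conjTranspose, add_comm]) W
  have h2 := hΞ.trace_of_isHermitian (M := Complex.I • M + (-Complex.I) • conjTransposeMap M)
    (fun X => by simp [hM, hM'])
    (by rw [choi_add, choi_smul, choi_smul, choi_conjTransposeMap, Matrix.IsHermitian,
          Matrix.conjTranspose_add, Matrix.conjTranspose_smul, Matrix.conjTranspose_smul,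
          Matrix.conjTranspose_conjTranspose, add_comm]
        simp) W
  simp only [map_add, map_smul, LinearMap.add_apply, LinearMap.smul_apply, Matrix.trace_add,
    Matrix.trace_smul, smul_eq_mul] at h1 h2
  linear_combination (1 / 2 : ℂ) * h1 - (Complex.I / 2) * h2 +
    (1 / 2 : ℂ) * ((Ξ M W).trace - (Ξ (conjTransposeMap M) W).trace) * Complex.I_sq

/-- The difference from the depolarizing channel annihilates traces. Complete positivity of `M` is
not required; maps built from phase-space point operators need not have it. -/
theorem IsSuperchannel.trace_eq (hΞ : IsSuperchannel Ξ) {M : Op A →ₗ[ℂ] Op B}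
    (hM : ∀ X, (M X).trace = X.trace) (W : Op C) : (Ξ M W).trace = W.trace := by
  have h := hΞ.trace_eq_zero
    (M := M - (B.dim : ℂ)⁻¹ • measurePrepare (1 : Op A) (1 : Op B))
    (fun X => by rw [LinearMap.sub_apply, Matrix.trace_sub, hM, isChannel_depolarizing.2, sub_self])
    W
  rw [map_sub, LinearMap.sub_apply, Matrix.trace_sub,
    hΞ.trace_of_isChannel isChannel_depolarizing] at h
  exact sub_eq_zero.1 h

end Superchannel

/-! ### Wigner functions of products, of Choi matrices, and of channels -/

section WignerKernel

variable {A B C D : QSystem}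

theorem QSystem.nonneg_of_inv_dim_mul (S : QSystem) {z : ℂ} (h : 0 ≤ (S.dim : ℂ)⁻¹ * z) :
    0 ≤ z := by
  have h1 : (0 : ℂ) ≤ S.dim * ((S.dim : ℂ)⁻¹ * z) := mul_nonneg (by positivity) h
  rwa [mul_inv_cancel_left₀ S.dim_ne_zero] at h1

theorem wigner_smul (c : ℂ) (X : Op A) (u : A.Phase) :
    wigner A (c • X) u = c * wigner A X u := by
  simp only [wigner, Matrix.mul_smul, Matrix.trace_smul, smul_eq_mul]
  ring

theorem wigner_sum {σ : Type} (s : Finset σ) (X : σ → Op A) (u : A.Phase) :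
    wigner A (∑ k ∈ s, X k) u = ∑ k ∈ s, wigner A (X k) u := by
  simp only [wigner, Matrix.trace_sum, Finset.mul_sum]

theorem wigner_tensor (X : Op (A.tensor B)) (u : A.Phase) (v : B.Phase) :
    wigner (A.tensor B) X (u, v) = (A.dim : ℂ)⁻¹ * (B.dim : ℂ)⁻¹ *
      Matrix.trace (n := A.Basis × B.Basis) ((phasePoint A u ⊗ₖ phasePoint B v) * X) := by
  rw [wigner, phasePoint_tensor, QSystem.dim_tensor, Nat.cast_mul, mul_inv]

theorem wigner_kronecker (X : Op A) (Y : Op B) (u : A.Phase) (v : B.Phase) :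
    wigner (A.tensor B) (X ⊗ₖ Y) (u, v) = wigner A X u * wigner B Y v := by
  rw [wigner_tensor, ← Matrix.mul_kronecker_mul, Matrix.trace_kronecker, wigner, wigner]
  ring

theorem wigner_phasePoint_nonneg (u v : A.Phase) : 0 ≤ wigner A (phasePoint A u) v :=
  mul_nonneg (by positivity) (trace_phasePoint_mul_nonneg A v u)

theorem trace_kronecker_mul_choi {α β : Type} [Fintype α] [Fintype β] [DecidableEq α]
    (Φ : Matrix α α ℂ →ₗ[ℂ] Matrix β β ℂ) (P : Matrix α α ℂ) (Q : Matrix β β ℂ) :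
    ((P ⊗ₖ Q) * choi Φ).trace = (Q * Φ P.transpose).trace := by
  simp only [Matrix.trace, Matrix.diag_apply, Matrix.mul_apply, Fintype.sum_prod_type,
    apply_eq_sum_choi, Matrix.kroneckerMap_apply, Matrix.transpose_apply, Finset.mul_sum]
  rw [Finset.sum_comm]
  refine Finset.sum_congr rfl fun b _ => ?_
  refine (Finset.sum_congr rfl fun a _ => Finset.sum_comm).trans ?_
  rw [Finset.sum_comm]
  refine Finset.sum_congr rfl fun b' _ => ?_
  rw [Finset.sum_comm]
  refine Finset.sum_congr rfl fun a _ => Finset.sum_congr rfl fun a' _ => ?_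
  ring

/-- Pairing with a Choi matrix transposes the input operator, and transposing a point operator
reflects its point. -/
theorem wigner_choi (Φ : Op A →ₗ[ℂ] Op B) (u : A.Phase) (v : B.Phase) :
    wigner (A.tensor B) (choi Φ) (u, v) =
      (A.dim : ℂ)⁻¹ * wigner B (Φ (phasePoint A (A.reflect u))) v := by
  rw [wigner_tensor, trace_kronecker_mul_choi, ← phasePoint_reflect, wigner]
  ring

theorem QSystem.reflect_reflect : ∀ (A : QSystem) (u : A.Phase), A.reflect (A.reflect u) = u
  | .unit, _ => rfl
  | .prime _ _ _, _ => Prod.ext (neg_neg _) rfl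
  | .tensor A B, u => Prod.ext (reflect_reflect A u.1) (reflect_reflect B u.2)

theorem wigner_choi_id_nonneg (u v : A.Phase) :
    0 ≤ wigner (A.tensor A) (choi (LinearMap.id : Op A →ₗ[ℂ] Op A)) (u, v) := by
  rw [wigner_choi]
  exact mul_nonneg (by positivity) (wigner_phasePoint_nonneg _ _)

theorem isCompletelyPositive_id {α : Type} :
    IsCompletelyPositive (LinearMap.id : Matrix α α ℂ →ₗ[ℂ] Matrix α α ℂ) := by
  intro n X hX
  convert hX using 1
  ext p q
  rw [ampliation_apply]
  rfl

theorem trace_choi {α β : Type} [Fintype α] [Fintype β] [DecidableEq α]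
    {Φ : Matrix α α ℂ →ₗ[ℂ] Matrix β β ℂ} (hΦ : ∀ X, (Φ X).trace = X.trace) :
    (choi Φ).trace = Fintype.card α := by
  have h : ∀ a, ∑ b, Φ (Matrix.single a a 1) b b = 1 := fun a =>
    (hΦ _).trans (Matrix.trace_single_eq_same a 1)
  simp [Matrix.trace, Fintype.sum_prod_type, choi, h]

theorem ampliation_choi_id {α β : Type} [Fintype α] [DecidableEq α]
    (Φ : Matrix α α ℂ →ₗ[ℂ] Matrix β β ℂ) :
    ampliation α Φ (choi LinearMap.id) = choi Φ := by
  ext p q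
  rw [ampliation_apply]
  rfl

/-- A completely positive-Wigner-preserving map has a non-negative Wigner kernel. -/
theorem IsCPWP.wigner_nonneg {Φ : Op A →ₗ[ℂ] Op B} (h : IsCPWP Φ) (u : A.Phase) (v : B.Phase) :
    0 ≤ wigner B (Φ (phasePoint A u)) v := by
  -- The normalised maximally entangled state has non-negative Wigner function, and its image under
  -- `id ⊗ Φ` is the normalised Choi matrix of `Φ`.
  have hρ : ((A.dim : ℂ)⁻¹ • choi (LinearMap.id : Op A →ₗ[ℂ] Op A) : Op (A.tensor A)) ∈
      wignerPolytope (A.tensor A) := by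
    refine ⟨⟨?_, ?_⟩, ?_⟩
    · exact (isCompletelyPositive_iff_choi.1 isCompletelyPositive_id).smul (by positivity)
    · refine (Matrix.trace_smul (n := A.Basis × A.Basis) _ _).trans ?_
      rw [trace_choi fun _ => rfl]
      exact inv_mul_cancel₀ A.dim_ne_zero
    · rintro ⟨u, v⟩
      refine le_of_le_of_eq ?_ (wigner_smul (A := A.tensor A) _ _ _).symm
      exact mul_nonneg (by positivity) (wigner_choi_id_nonneg u v)
  have h1 := (h.2 A _ hρ).2 (A.reflect u, v)
  have h2 : ampliation A.Basis Φ ((A.dim : ℂ)⁻¹ • choi (LinearMap.id : Op A →ₗ[ℂ] Op A)) =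
      (A.dim : ℂ)⁻¹ • choi Φ := by
    rw [map_smul, ampliation_choi_id]
  rw [h2] at h1
  have h3 := le_of_le_of_eq h1 (wigner_smul (A := A.tensor B) _ _ _)
  rw [wigner_choi, QSystem.reflect_reflect] at h3
  exact A.nonneg_of_inv_dim_mul (A.nonneg_of_inv_dim_mul h3)

/-- A channel with a non-negative Wigner kernel is completely positive-Wigner-preserving. -/
theorem IsChannel.isCPWP {Φ : Op A →ₗ[ℂ] Op B} (hΦ : IsChannel Φ)
    (h : ∀ u v, 0 ≤ wigner B (Φ (phasePoint A u)) v) : IsCPWP Φ := by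
  refine ⟨fun X hX => ?_, fun R ρ hρ => ⟨(hΦ.isChannel_ampliation (ι := R.Basis)).isState hρ.1, ?_⟩⟩
  · rw [Matrix.IsHermitian, ← hΦ.1.map_conjTranspose, hX]
  · rintro ⟨r, v⟩
    have h1 : ampliation R.Basis Φ ρ =
        ∑ u : R.Phase × A.Phase, wigner (R.tensor A) ρ u • (phasePoint R u.1 ⊗ₖ
          Φ (phasePoint A u.2)) := by
      conv_lhs => rw [← wigner_expansion (R.tensor A) ρ]
      refine (map_sum (ampliation R.Basis Φ) _ _).trans ?_
      refine Finset.sum_congr rfl fun u _ => ?_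
      refine ((ampliation R.Basis Φ).map_smul _ _).trans ?_
      rw [phasePoint_tensor, ampliation_kronecker]
    rw [h1]
    refine le_of_le_of_eq ?_ (wigner_sum (A := R.tensor B) _ _ _).symm
    refine Finset.sum_nonneg fun u _ => ?_
    refine le_of_le_of_eq ?_ (wigner_smul (A := R.tensor B) _ _ _).symm
    refine mul_nonneg (hρ.2 u) ?_
    rw [wigner_kronecker]
    exact mul_nonneg (wigner_phasePoint_nonneg _ _) (h _ _)

end WignerKernel

/-! ### The Wigner kernel of a CPWP superchannel -/

section SuperKernel

variable {A B C D : QSystem} {Ξ : (Op A →ₗ[ℂ] Op B) →ₗ[ℂ] (Op C →ₗ[ℂ] Op D)}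

theorem entangler_kronecker {α β ι : Type} [Fintype α] [Fintype ι] [Fintype β] [DecidableEq α]
    [DecidableEq β] [DecidableEq ι] (Y : Matrix ι ι ℂ) (Z : Matrix α α ℂ) :
    entangler (β := β) (Y ⊗ₖ Z) = Y.trace • (Z ⊗ₖ choi (LinearMap.id (M := Matrix β β ℂ))).submatrix
      (Equiv.prodAssoc α β β) (Equiv.prodAssoc α β β) := by
  ext p q
  simp only [entangler_apply, Matrix.kroneckerMap_apply, ← Finset.sum_mul, Matrix.smul_apply,
    Matrix.submatrix_apply, choi, LinearMap.id_apply, Matrix.of_apply, Matrix.single_apply,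
    smul_eq_mul, Equiv.prodAssoc_apply]
  split_ifs <;> simp_all [Matrix.trace]

/-- A product of point operators goes to a point operator on `A` tensored with a maximally entangled
state on `BB`, because the discarded factor has trace one. Both factors have non-negative Wigner
functions. -/
theorem wigner_entanglingChannel_nonneg (u : ((A.tensor B).tensor A).Phase)
    (v : ((A.tensor B).tensor B).Phase) :
    0 ≤ wigner ((A.tensor B).tensor B)
      (entanglingChannel A B (phasePoint ((A.tensor B).tensor A) u)) v := by
  obtain ⟨r, a⟩ := u
  obtain ⟨⟨a', b⟩, b'⟩ := v
  have h1 : entanglingChannel A B (phasePoint ((A.tensor B).tensor A) (r, a)) =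
      (B.dim : ℂ)⁻¹ • (phasePoint A a ⊗ₖ choi (LinearMap.id : Op B →ₗ[ℂ] Op B)).submatrix
      (Equiv.prodAssoc A.Basis B.Basis B.Basis) (Equiv.prodAssoc A.Basis B.Basis B.Basis) := by
    rw [phasePoint_tensor]
    refine congrArg (fun z => (B.dim : ℂ)⁻¹ • z)
      ((entangler_kronecker (β := B.Basis) (phasePoint (A.tensor B) r) (phasePoint A a)).trans ?_)
    have := trace_phasePoint (A.tensor B) r
    refine (congrArg (fun z : ℂ => z • _) this).trans ?_
    exact one_smul _ _
  rw [h1]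
  refine le_of_le_of_eq ?_ (wigner_smul (A := (A.tensor B).tensor B) _ _ _).symm
  refine mul_nonneg (by positivity) ?_
  rw [wigner_tensor, phasePoint_tensor]
  refine mul_nonneg (by positivity) ?_
  have h2 : (phasePoint A a' ⊗ₖ phasePoint B b) ⊗ₖ phasePoint B b' =
      (phasePoint A a' ⊗ₖ (phasePoint B b ⊗ₖ phasePoint B b')).submatrix
      (Equiv.prodAssoc A.Basis B.Basis B.Basis) (Equiv.prodAssoc A.Basis B.Basis B.Basis) := by
    ext p q
    simp [mul_assoc]
  have h3 : ((phasePoint A a' ⊗ₖ phasePoint B b) ⊗ₖ phasePoint B b' *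
      (phasePoint A a ⊗ₖ choi (LinearMap.id : Op B →ₗ[ℂ] Op B)).submatrix
      (Equiv.prodAssoc A.Basis B.Basis B.Basis) (Equiv.prodAssoc A.Basis B.Basis B.Basis)).trace =
      (phasePoint A a' * phasePoint A a).trace *
      (phasePoint B b' * phasePoint B (B.reflect b)).trace := by
    rw [h2, Matrix.submatrix_mul_equiv, ← Matrix.mul_kronecker_mul, phasePoint_reflect,
      ← LinearMap.id_apply (R := ℂ) (phasePoint B b).transpose, ← trace_kronecker_mul_choi,
      ← Matrix.trace_kronecker]
    exact Equiv.sum_comp (Equiv.prodAssoc A.Basis B.Basis B.Basis) fun x =>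
      (phasePoint A a' * phasePoint A a) x.1 x.1 * (phasePoint B b ⊗ₖ phasePoint B b' *
        choi (LinearMap.id : Op B →ₗ[ℂ] Op B)) x.2 x.2
  exact le_of_le_of_eq (mul_nonneg (trace_phasePoint_mul_nonneg A a' a)
    (trace_phasePoint_mul_nonneg B b' _)) h3.symm

theorem isCPWP_entanglingChannel : IsCPWP (entanglingChannel A B) :=
  isChannel_entanglingChannel.isCPWP wigner_entanglingChannel_nonneg

/-- This is the Choi-state argument one level up: up to positive dimension factors, these numbers
are Wigner values of `id ⊗ Ξ` applied to the CPWP entangling channel. -/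
theorem IsCPWPSuperchannel.wigner_nonneg (hΞ : IsCPWPSuperchannel Ξ) (a : A.Phase) (b : B.Phase)
    (c : C.Phase) (d : D.Phase) :
    0 ≤ wigner D (Ξ (measurePrepare (phasePoint A a) (phasePoint B b)) (phasePoint C c)) d := by
  have h := (hΞ.2 (A.tensor B) _ isChannel_entanglingChannel isCPWP_entanglingChannel).wigner_nonneg
    -- Any reference point would serve in place of the origin, since the reference is traced out.
    -- Reflecting `b` cancels the transpose in the pairing with the Choi map.
    ((A.tensor B).origin, c) ((a, B.reflect b), d)
  have h1 : ∑ r : A.Basis × B.Basis, blockProj r r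
      (phasePoint ((A.tensor B).tensor C) ((A.tensor B).origin, c)) = phasePoint C c := by
    rw [phasePoint_tensor]
    have : ∀ r : A.Basis × B.Basis,
        blockProj r r (phasePoint (A.tensor B) (A.tensor B).origin ⊗ₖ phasePoint C c) =
        phasePoint (A.tensor B) (A.tensor B).origin r r • phasePoint C c := by
      intro r; ext i j; simp [blockProj]
    rw [Finset.sum_congr rfl fun r _ => this r, ← Finset.sum_smul]
    refine (congrArg (fun z : ℂ => z • phasePoint C c)
      (trace_phasePoint (A.tensor B) (A.tensor B).origin)).trans (one_smul _ _)
  rw [idTensor_entanglingChannel, h1] at h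
  have h2 := le_of_le_of_eq h (wigner_smul (A := (A.tensor B).tensor D) _ _ _)
  rw [wigner_tensor, phasePoint_tensor] at h2
  have h3 := trace_kronecker_mul_superChoi Ξ (phasePoint A a) (phasePoint B (B.reflect b))
    (phasePoint D d) (phasePoint C c)
  rw [← phasePoint_reflect, B.reflect_reflect] at h3
  have h4 := le_of_le_of_eq h2 (congrArg (fun z => (B.dim : ℂ)⁻¹ * (((A.tensor B).dim : ℂ)⁻¹ *
    (D.dim : ℂ)⁻¹ * z)) h3)
  have h5 := B.nonneg_of_inv_dim_mul h4
  rw [mul_assoc] at h5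
  exact (A.tensor B).nonneg_of_inv_dim_mul h5

theorem map_eq_sum_measurePrepare (E : Op A →ₗ[ℂ] Op B) :
    E = ∑ a, ∑ b, ((A.dim : ℂ)⁻¹ * wigner B (E (phasePoint A a)) b) •
      measurePrepare (phasePoint A a) (phasePoint B b) := by
  apply LinearMap.ext
  intro X
  conv_lhs => rw [← wigner_expansion A X, map_sum]
  simp only [LinearMap.sum_apply, LinearMap.smul_apply, measurePrepare_apply]
  refine Finset.sum_congr rfl fun a _ => ?_
  rw [map_smul]
  conv_lhs => rw [← wigner_expansion B (E (phasePoint A a)), Finset.smul_sum]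
  refine Finset.sum_congr rfl fun b _ => ?_
  rw [smul_smul, smul_smul, wigner]
  congr 1
  ring

theorem IsCPWPSuperchannel.wignerTraceNorm_le (hΞ : IsCPWPSuperchannel Ξ) {E : Op A →ₗ[ℂ] Op B}
    (hE : ∀ a, wignerTraceNorm B (E (phasePoint A a)) ≤ 1) (c : C.Phase) :
    wignerTraceNorm D (Ξ E (phasePoint C c)) ≤ 1 := by
  let M : A.Phase → B.Phase → (Op A →ₗ[ℂ] Op B) := fun a b =>
    (A.dim : ℂ)⁻¹ • measurePrepare (phasePoint A a) (phasePoint B b)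
  let S : A.Phase → B.Phase → D.Phase → ℂ := fun a b d => wigner D (Ξ (M a b) (phasePoint C c)) d
  let t : A.Phase → ℂ := fun a => (Ξ (M a B.origin) (phasePoint C c)).trace
  have hS : ∀ a b d, 0 ≤ S a b d := by
    intro a b d
    simp only [S, M]
    rw [map_smul, LinearMap.smul_apply, wigner_smul]
    exact mul_nonneg (by positivity) (hΞ.wigner_nonneg a b c d)
  -- Independence of `b`: as `tr A_b = 1`, the map `M a b - M a B.origin` annihilates traces.
  have hSt : ∀ a b, ∑ d, S a b d = t a := by
    intro a b
    simp only [S, t]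
    rw [sum_wigner]
    have h := hΞ.1.trace_eq_zero (M := M a b - M a B.origin) (fun X => by
      simp [M, measurePrepare_apply, trace_phasePoint]) (phasePoint C c)
    rw [map_sub, LinearMap.sub_apply, Matrix.trace_sub] at h
    exact sub_eq_zero.1 h
  -- Since `∑ A_a = d · 1`, the sum of the `M a B.origin` is trace preserving.
  have ht : ∑ a, t a = 1 := by
    have h := hΞ.1.trace_eq (M := ∑ a, M a B.origin) (fun X => by
      simp only [M, LinearMap.sum_apply, LinearMap.smul_apply, measurePrepare_apply,
        Matrix.trace_sum, Matrix.trace_smul, trace_phasePoint, smul_eq_mul, mul_one]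
      rw [← Finset.mul_sum, ← Matrix.trace_sum, ← Matrix.sum_mul, sum_phasePoint,
        Matrix.smul_mul, one_mul, Matrix.trace_smul, smul_eq_mul,
        inv_mul_cancel_left₀ A.dim_ne_zero]) (phasePoint C c)
    rw [map_sum, LinearMap.sum_apply, Matrix.trace_sum, trace_phasePoint] at h
    exact h
  have hnorm : ∀ a b, ∑ d, ‖S a b d‖ = ‖t a‖ := by
    intro a b
    have h0 : 0 ≤ t a := by rw [← hSt a b]; exact Finset.sum_nonneg fun d _ => hS a b d
    have h1 : ((∑ d, ‖S a b d‖ : ℝ) : ℂ) = (‖t a‖ : ℂ) := by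
      rw [← Complex.eq_coe_norm_of_nonneg h0, ← hSt a b, Complex.ofReal_sum]
      exact Finset.sum_congr rfl fun d _ => (Complex.eq_coe_norm_of_nonneg (hS a b d)).symm
    exact_mod_cast h1
  have htnorm : ∑ a, ‖t a‖ = 1 := by
    have h1 : ((∑ a, ‖t a‖ : ℝ) : ℂ) = 1 := by
      rw [← ht, Complex.ofReal_sum]
      refine Finset.sum_congr rfl fun a _ => (Complex.eq_coe_norm_of_nonneg ?_).symm
      rw [← hSt a B.origin]
      exact Finset.sum_nonneg fun d _ => hS a _ d
    exact_mod_cast h1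
  have hexp : ∀ d, wigner D (Ξ E (phasePoint C c)) d =
      ∑ a, ∑ b, wigner B (E (phasePoint A a)) b * S a b d := by
    intro d
    have : E = ∑ a, ∑ b, wigner B (E (phasePoint A a)) b • M a b := by
      conv_lhs => rw [map_eq_sum_measurePrepare E]
      simp only [M, smul_smul, mul_comm]
    conv_lhs => rw [this]
    simp only [map_sum, map_smul, LinearMap.sum_apply, LinearMap.smul_apply, wigner_sum,
      wigner_smul, S]
  calc wignerTraceNorm D (Ξ E (phasePoint C c))
      = ∑ d, ‖∑ a, ∑ b, wigner B (E (phasePoint A a)) b * S a b d‖ := by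
        simp only [wignerTraceNorm, hexp]
    _ ≤ ∑ d, ∑ a, ∑ b, ‖wigner B (E (phasePoint A a)) b‖ * ‖S a b d‖ := by
        refine Finset.sum_le_sum fun d _ => (norm_sum_le _ _).trans ?_
        refine Finset.sum_le_sum fun a _ => (norm_sum_le _ _).trans ?_
        exact Finset.sum_le_sum fun b _ => (norm_mul _ _).le
    _ = ∑ a, wignerTraceNorm B (E (phasePoint A a)) * ‖t a‖ := by
        rw [Finset.sum_comm]
        refine Finset.sum_congr rfl fun a _ => ?_
        rw [Finset.sum_comm, wignerTraceNorm, Finset.sum_mul]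
        refine Finset.sum_congr rfl fun b _ => ?_
        rw [← Finset.mul_sum, hnorm]
    _ ≤ ∑ a, 1 * ‖t a‖ := Finset.sum_le_sum fun a _ =>
        mul_le_mul_of_nonneg_right (hE a) (norm_nonneg _)
    _ = 1 := by simp only [one_mul, htnorm]

theorem mana_nonpos_iff (E : Op A →ₗ[ℂ] Op B) :
    mana E ≤ 0 ↔ ∀ a, wignerTraceNorm B (E (phasePoint A a)) ≤ 1 := by
  rw [mana, ENNReal.log_le_zero_iff, iSup_le_iff]
  simp only [ENNReal.ofReal_le_one]

end SuperKernel

/-! ### Realization of a superchannel on a fixed pure input -/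

section Realization

variable {α β γ δ μ κ : Type} [Fintype α] [Fintype β] [Fintype γ] [Fintype δ] [Fintype μ]
  [Fintype κ] [DecidableEq α] [DecidableEq β] [DecidableEq γ] [DecidableEq δ] [DecidableEq μ]
  [DecidableEq κ]

theorem isCompletelyPositive_measurePrepare {P : Matrix μ μ ℂ} {Y : Matrix κ κ ℂ}
    (hP : P.PosSemidef) (hY : Y.PosSemidef) : IsCompletelyPositive (measurePrepare P Y) := by
  rw [isCompletelyPositive_iff_choi, choi_measurePrepare]
  exact hP.transpose.kronecker hY

/-- A completely positive map `Λ` with `tr Λ(Y) = tr (S² Y)` factors as `Y ↦ Φ(S Y S)` with a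
channel `Φ`. -/
theorem IsCompletelyPositive.exists_channel [Nonempty κ]
    {Λ : Matrix μ μ ℂ →ₗ[ℂ] Matrix κ κ ℂ} (hΛ : IsCompletelyPositive Λ) {S T Q : Matrix μ μ ℂ}
    (hT : T.IsHermitian) (hQ : Q.IsHermitian) (hTS : T * S = 1 - Q) (hST : S * T = 1 - Q)
    (hQS : Q * S = 0) (hSQ : S * Q = 0) (hQQ : Q * Q = Q)
    (htr : ∀ Y, (Λ Y).trace = (S * S * Y).trace) :
    ∃ Φ : Matrix μ μ ℂ →ₗ[ℂ] Matrix κ κ ℂ, IsChannel Φ ∧ ∀ Y, Φ (S * Y * S) = Λ Y := by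
  obtain ⟨K, hK⟩ := exists_kraus hΛ.posSemidef_choi
  -- The trace of `Λ Q` is `tr (S² Q) = 0` and also the sum of the squared Hilbert–Schmidt norms of
  -- the `K k * Q`.
  have hKQ : ∀ k, K k * Q = 0 := by
    have h0 : ∑ k, ((K k * Q) * (K k * Q).conjTranspose).trace = 0 := by
      have h := htr (Q * Q)
      rw [Matrix.mul_assoc S S, ← Matrix.mul_assoc S Q, hSQ, Matrix.zero_mul, Matrix.mul_zero,
        Matrix.trace_zero, hK, LinearMap.sum_apply, Matrix.trace_sum] at h
      rw [← h]
      refine Finset.sum_congr rfl fun k _ => ?_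
      simp only [_root_.conjMap, LinearMap.coe_mk, AddHom.coe_mk, Matrix.conjTranspose_mul, hQ.eq,
        Matrix.mul_assoc]
    intro k
    rw [← Matrix.trace_mul_conjTranspose_self_eq_zero_iff]
    exact (Finset.sum_eq_zero_iff_of_nonneg fun k _ =>
      (Matrix.posSemidef_self_mul_conjTranspose (K k * Q)).trace_nonneg).1 h0 k (Finset.mem_univ k)
  have hΛQ : ∀ Y, Λ ((1 - Q) * Y * (1 - Q)) = Λ Y := by
    intro Y
    rw [hK, LinearMap.sum_apply, LinearMap.sum_apply]
    refine Finset.sum_congr rfl fun k _ => ?_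
    have h1 : K k * (1 - Q) = K k := by rw [Matrix.mul_sub, Matrix.mul_one, hKQ, sub_zero]
    have h2 : (1 - Q) * (K k).conjTranspose = (K k).conjTranspose := by
      rw [Matrix.sub_mul, Matrix.one_mul, ← hQ.eq, ← Matrix.conjTranspose_mul, hKQ,
        Matrix.conjTranspose_zero, sub_zero]
    calc _ = K k * (1 - Q) * Y * ((1 - Q) * (K k).conjTranspose) := by
          simp only [_root_.conjMap, LinearMap.coe_mk, AddHom.coe_mk, Matrix.mul_assoc]
      _ = _ := by rw [h1, h2]; rfl
  let x : κ := Classical.arbitrary κ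
  have hx : (Matrix.single x x (1 : ℂ)).PosSemidef := by
    rw [← Matrix.diagonal_single]
    exact Matrix.PosSemidef.diagonal (Pi.single_nonneg.2 zero_le_one)
  have hQp : Q.PosSemidef := by
    have := Matrix.posSemidef_conjTranspose_mul_self Q
    rwa [hQ.eq, hQQ] at this
  -- The first term undoes `S` on its support. The second restores the trace lost on the kernel, and
  -- vanishes on every `S * Y * S`.
  refine ⟨Λ ∘ₗ conjMap T + measurePrepare Q (Matrix.single x x 1), ⟨?_, fun Z => ?_⟩, fun Y => ?_⟩
  · exact (hΛ.comp (isCompletelyPositive_conjMap T)).add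
      (isCompletelyPositive_measurePrepare hQp hx)
  · have h1 : (S * S * (T * Z * T)).trace = ((1 - Q) * Z).trace := by
      calc _ = (S * (S * T) * Z * T).trace := by simp only [Matrix.mul_assoc]
        _ = (T * (S * (S * T) * Z)).trace := Matrix.trace_mul_comm _ _
        _ = (T * S * (S * T) * Z).trace := by simp only [Matrix.mul_assoc]
        _ = _ := by
          rw [hTS, hST, Matrix.mul_sub (1 - Q), Matrix.sub_mul 1 Q Q, hQQ]
          simp
    rw [LinearMap.add_apply, Matrix.trace_add, LinearMap.comp_apply, htr, measurePrepare_apply,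
      Matrix.trace_smul, Matrix.trace_single_eq_same, smul_eq_mul, mul_one]
    have h2 : conjMap T Z = T * Z * T := congrArg (fun M => T * Z * M) hT
    rw [h2, h1, Matrix.sub_mul, Matrix.trace_sub, Matrix.one_mul, sub_add_cancel]
  · have h2 : conjMap T (S * Y * S) = (1 - Q) * Y * (1 - Q) := by
      calc _ = T * (S * Y * S) * T := congrArg (fun M => T * (S * Y * S) * M) hT
        _ = T * S * Y * (S * T) := by simp only [Matrix.mul_assoc]
        _ = _ := by rw [hTS, hST]
    rw [LinearMap.add_apply, LinearMap.comp_apply, h2, hΛQ, measurePrepare_apply,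
      ← Matrix.mul_assoc, ← Matrix.mul_assoc, hQS, Matrix.zero_mul, Matrix.zero_mul,
      Matrix.trace_zero, zero_smul, add_zero]

/-- The vector with entries `F` is `F ⊗ 1` applied to the unnormalised maximally entangled vector,
and an operator on the reference commutes with `id ⊗ M`. -/
theorem ampliation_vecMulVec (M : Matrix α α ℂ →ₗ[ℂ] Matrix β β ℂ)
    (F : Matrix α α ℂ) :
    ampliation α M (Matrix.vecMulVec (fun p : α × α => F p.1 p.2)
      (star fun p : α × α => F p.1 p.2)) =
      (F ⊗ₖ (1 : Matrix β β ℂ)) * choi M * (F ⊗ₖ (1 : Matrix β β ℂ)).conjTranspose := by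
  ext p q
  rw [ampliation_apply, apply_eq_sum_choi]
  simp only [Matrix.mul_apply, Matrix.conjTranspose_apply, Matrix.kroneckerMap_apply,
    Fintype.sum_prod_type, Matrix.one_apply, mul_ite, mul_one, mul_zero, ite_mul, zero_mul,
    Finset.sum_ite_eq, Finset.mem_univ, if_true, apply_ite star, star_zero, blockProj,
    LinearMap.coe_mk, AddHom.coe_mk, Matrix.submatrix_apply, Matrix.vecMulVec_apply, Pi.star_apply,
    Finset.sum_mul]
  rw [Finset.sum_comm]
  refine Finset.sum_congr rfl fun a' _ => Finset.sum_congr rfl fun a _ => ?_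
  ring

omit [DecidableEq β] [DecidableEq α] [Fintype α] in
theorem trace_ampliation_eq (Φ : Matrix α α ℂ →ₗ[ℂ] Matrix β β ℂ)
    (X : Matrix (κ × α) (κ × α) ℂ) :
    (ampliation κ Φ X).trace = (Φ (∑ r, blockProj r r X)).trace := by
  simp only [map_sum, Matrix.trace_sum]
  simp only [Matrix.trace, Matrix.diag_apply, Fintype.sum_prod_type, ampliation_apply]

variable (Ξ : (Matrix α α ℂ →ₗ[ℂ] Matrix β β ℂ) →ₗ[ℂ] (Matrix γ γ ℂ →ₗ[ℂ] Matrix δ δ ℂ))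

/-- The map that sends the Choi matrix of `M` to `(id ⊗ Ξ(M))(ρ)`. -/
def evalMap (ρ : Matrix (κ × γ) (κ × γ) ℂ) :
    Matrix (α × β) (α × β) ℂ →ₗ[ℂ] Matrix (κ × δ) (κ × δ) ℂ where
  toFun Y := ∑ q, ∑ q', Y q q' • ampliation κ (Ξ (unitMap q q')) ρ
  map_add' X Y := by simp only [Matrix.add_apply, add_smul, Finset.sum_add_distrib]
  map_smul' c X := by
    simp only [Matrix.smul_apply, smul_assoc, Finset.smul_sum, RingHom.id_apply]

omit [Fintype γ] [Fintype δ] [DecidableEq γ] [DecidableEq δ] in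
theorem evalMap_choi (ρ : Matrix (κ × γ) (κ × γ) ℂ) (M : Matrix α α ℂ →ₗ[ℂ] Matrix β β ℂ) :
    evalMap Ξ ρ (choi M) = ampliation κ (Ξ M) ρ := by
  conv_rhs => rw [← sum_choi_smul_unitMap M]
  simp only [map_sum, map_smul, ampliation_sum, ampliation_smul, LinearMap.sum_apply,
    LinearMap.smul_apply]
  rfl

omit [Fintype γ] [Fintype δ] [DecidableEq γ] [DecidableEq δ] in
theorem evalMap_single (ρ : Matrix (κ × γ) (κ × γ) ℂ) (q q' : α × β) :
    evalMap Ξ ρ (Matrix.single q q' 1) = ampliation κ (Ξ (unitMap q q')) ρ := by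
  change ∑ p, ∑ p', Matrix.single q q' (1 : ℂ) p p' • ampliation κ (Ξ (unitMap p p')) ρ = _
  rw [Finset.sum_eq_single q, Finset.sum_eq_single q']
  · simp
  · intro b _ hb; simp [hb.symm]
  · simp
  · intro b _ hb; simp [hb.symm]
  · simp

omit [Fintype γ] [DecidableEq γ] in
-- The Choi matrix of `evalMap Ξ ρ` is `(id ⊗ superChoi Ξ)(ρ)` with its tensor factors reordered.
theorem isCompletelyPositive_evalMap (hΞ : IsCompletelyPositive (superChoi Ξ))
    {ρ : Matrix (κ × γ) (κ × γ) ℂ} (hρ : ρ.PosSemidef) : IsCompletelyPositive (evalMap Ξ ρ) := by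
  rw [isCompletelyPositive_iff_choi]
  have h := (hΞ.posSemidef_ampliation hρ).submatrix
    (fun x : (α × β) × (κ × δ) => (x.2.1, (x.1, x.2.2)))
  convert h using 1
  ext x y
  rw [Matrix.submatrix_apply, ampliation_apply]
  simp only [choi, Matrix.of_apply]
  rw [evalMap_single, ampliation_apply]
  rfl

omit [Fintype α] [DecidableEq α] in
theorem trace_unitMap (q q' : α × β) (X : Matrix α α ℂ) :
    (unitMap q q' X).trace = if q.2 = q'.2 then X q.1 q'.1 else 0 := by
  change (X q.1 q'.1 • Matrix.single q.2 q'.2 (1 : ℂ)).trace = _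
  rw [Matrix.trace_smul]
  split_ifs with h
  · rw [h, Matrix.trace_single_eq_same, smul_eq_mul, mul_one]
  · rw [Matrix.trace_single_eq_of_ne _ _ _ h, smul_zero]

end Realization

/-! ### Reduction to a fixed pure input and data processing -/

section Monotonicity

variable {A B C D : QSystem} {Ξ : (Op A →ₗ[ℂ] Op B) →ₗ[ℂ] (Op C →ₗ[ℂ] Op D)}

theorem isState_vecMulVec {ι : Type} [Fintype ι] {ψ : ι → ℂ} (hψ : ∑ i, ‖ψ i‖ ^ 2 = 1) :
    IsState (Matrix.vecMulVec ψ (star ψ)) := by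
  refine ⟨Matrix.posSemidef_vecMulVec_self_star ψ, ?_⟩
  simp only [Matrix.trace, Matrix.diag_apply, Matrix.vecMulVec_apply, Pi.star_apply]
  rw [← Complex.ofReal_one, ← hψ, Complex.ofReal_sum]
  refine Finset.sum_congr rfl fun i _ => ?_
  rw [Complex.ofReal_pow]
  exact Complex.mul_conj' (ψ i)

/-- The trace of the output of a superchannel is governed by a state of the input system. -/
theorem IsSuperchannel.exists_marginal (hΞ : IsSuperchannel Ξ) {κ : Type} [Fintype κ]
    [DecidableEq κ] {ρ : Matrix (κ × C.Basis) (κ × C.Basis) ℂ} (hρ : IsState ρ) :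
    ∃ σ : Op A, IsState σ ∧
      ∀ Y, (evalMap Ξ ρ Y).trace = ((σ ⊗ₖ (1 : Op B)) * Y).trace := by
  let b₀ : B.Basis := Classical.arbitrary _
  let w : Op C := ∑ r, blockProj r r ρ
  have hw : w.trace = 1 := by
    have h : ρ.trace = w.trace := by
      simp only [w, Matrix.trace_sum]
      simp only [Matrix.trace, Matrix.diag_apply, Fintype.sum_prod_type]
      rfl
    rw [← h, hρ.2]
  let s : A.Basis → A.Basis → ℂ := fun a a' => (Ξ (unitMap (a, b₀) (a', b₀)) w).trace
  have hs : ∀ q q' : A.Basis × B.Basis, (ampliation κ (Ξ (unitMap q q')) ρ).trace =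
      if q.2 = q'.2 then s q.1 q'.1 else 0 := by
    intro q q'
    rw [trace_ampliation_eq]
    -- Unit maps with different output labels annihilate traces. When the labels agree, replacing
    -- both by `b₀` leaves the trace unchanged.
    have h := hΞ.trace_eq_zero (M := unitMap q q' - (if q.2 = q'.2 then (1 : ℂ) else 0) •
      unitMap (q.1, b₀) (q'.1, b₀)) (fun X => by
        rw [LinearMap.sub_apply, Matrix.trace_sub, LinearMap.smul_apply, Matrix.trace_smul]
        erw [trace_unitMap, trace_unitMap]
        split_ifs <;> simp_all) w
    rw [map_sub, LinearMap.sub_apply, Matrix.trace_sub, map_smul, LinearMap.smul_apply,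
      Matrix.trace_smul] at h
    refine (sub_eq_zero.1 h).trans ?_
    split_ifs <;> simp [s]
  -- The transposed index order fits the pairing `tr ((σ ⊗ 1) Y)`. Positivity holds because `s` is a
  -- sum of principal submatrices of the Choi matrix of `evalMap Ξ ρ`.
  refine ⟨Matrix.of fun a' a => s a a', ⟨?_, ?_⟩, fun Y => ?_⟩
  · have h := (isCompletelyPositive_evalMap Ξ hΞ.isCompletelyPositive_superChoi
      hρ.1).posSemidef_choi
    have h2 := (Matrix.posSemidef_sum Finset.univ fun p (_ : p ∈ Finset.univ) =>
      h.submatrix fun a : A.Basis => ((a, b₀), p)).transpose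
    refine cast (congrArg Matrix.PosSemidef (Matrix.ext fun a' a => Eq.symm ?_)) h2
    have h3 := hs (a, b₀) (a', b₀)
    rw [if_pos rfl] at h3
    rw [Matrix.of_apply, Matrix.transpose_apply, Matrix.sum_apply, ← h3]
    refine Finset.sum_congr rfl fun p _ => ?_
    rw [← evalMap_single]
    rfl
  · have h := hΞ.trace_eq (M := ∑ a, unitMap (a, b₀) (a, b₀)) (fun X => by
      rw [LinearMap.sum_apply, Matrix.trace_sum]
      refine Finset.sum_congr rfl fun a _ => ?_
      refine (trace_unitMap _ _ _).trans ?_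
      rw [if_pos rfl]
      rfl) w
    rw [hw, map_sum Ξ, LinearMap.sum_apply, Matrix.trace_sum] at h
    exact h
  · change (∑ q, ∑ q', Y q q' • ampliation κ (Ξ (unitMap q q')) ρ).trace = _
    simp only [Matrix.trace_sum, Matrix.trace_smul, hs]
    simp only [Matrix.trace, Matrix.diag_apply, Matrix.mul_apply, Matrix.kroneckerMap_apply,
      Matrix.of_apply, Matrix.one_apply]
    rw [Finset.sum_comm]
    refine Finset.sum_congr rfl fun q' _ => Finset.sum_congr rfl fun q _ => ?_
    by_cases h : q.2 = q'.2
    · rw [if_pos h, if_pos h.symm, smul_eq_mul, mul_one, mul_comm]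
    · rw [if_neg h, if_neg (Ne.symm h), smul_zero, mul_zero, zero_mul]

/-- On a pure input, a superchannel acts as a channel on the output of the given map on a fixed
pure input. -/
theorem IsSuperchannel.exists_channel (hΞ : IsSuperchannel Ξ) {ψ : C.Basis × C.Basis → ℂ}
    (hψ : ∑ i, ‖ψ i‖ ^ 2 = 1) :
    ∃ (φ : A.Basis × A.Basis → ℂ) (Φ : Op (A.tensor B) →ₗ[ℂ] Op (C.tensor D)),
      ∑ i, ‖φ i‖ ^ 2 = 1 ∧ IsChannel Φ ∧ ∀ M : Op A →ₗ[ℂ] Op B,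
        Φ (ampliation A.Basis M (Matrix.vecMulVec φ (star φ))) =
          ampliation C.Basis (Ξ M) (Matrix.vecMulVec ψ (star ψ)) := by
  have hρ := isState_vecMulVec hψ
  obtain ⟨σ, hσ, htr⟩ := hΞ.exists_marginal hρ
  obtain ⟨S, T, Q, hS, hT, hQ, hSS, hTS, hST, hQS, hSQ, hQQ⟩ := hσ.1.exists_sqrt_pinv
  have hmul : ∀ X Y : Op A, (X ⊗ₖ (1 : Op B)) * (Y ⊗ₖ (1 : Op B)) = (X * Y) ⊗ₖ (1 : Op B) := by
    intro X Y
    rw [← Matrix.mul_kronecker_mul, one_mul]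
  have hherm : ∀ X : Op A, X.IsHermitian → (X ⊗ₖ (1 : Op B)).IsHermitian := by
    intro X hX
    rw [Matrix.IsHermitian, Matrix.conjTranspose_kronecker, hX.eq, Matrix.conjTranspose_one]
  have hsub : (1 - Q) ⊗ₖ (1 : Op B) = 1 - Q ⊗ₖ (1 : Op B) := by
    rw [eq_sub_iff_add_eq, ← Matrix.add_kronecker, sub_add_cancel, Matrix.one_kronecker_one]
  obtain ⟨Φ, hΦ, hΦY⟩ := (isCompletelyPositive_evalMap Ξ hΞ.isCompletelyPositive_superChoi
    hρ.1).exists_channel (S := S ⊗ₖ (1 : Op B)) (T := T ⊗ₖ (1 : Op B)) (Q := Q ⊗ₖ (1 : Op B))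
    (hherm T hT) (hherm Q hQ) (by rw [hmul, hTS, hsub]) (by rw [hmul, hST, hsub])
    (by rw [hmul, hQS, Matrix.zero_kronecker]) (by rw [hmul, hSQ, Matrix.zero_kronecker])
    (by rw [hmul, hQQ]) (fun Y => by rw [hmul, hSS]; exact htr Y)
  -- The entries of `S = √σ` form a unit vector because `tr S² = tr σ = 1`.
  refine ⟨fun p => S p.1 p.2, Φ, ?_, hΦ, fun M => ?_⟩
  · have h : (S * S).trace = 1 := by rw [hSS, hσ.2]
    have h2 : ((∑ i : A.Basis × A.Basis, ‖S i.1 i.2‖ ^ 2 : ℝ) : ℂ) = 1 := by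
      rw [← h, Complex.ofReal_sum, Fintype.sum_prod_type]
      simp only [Matrix.trace, Matrix.diag_apply, Matrix.mul_apply]
      refine Finset.sum_congr rfl fun i _ => Finset.sum_congr rfl fun j _ => ?_
      rw [← hS.apply j i, Complex.ofReal_pow]
      exact (Complex.mul_conj' _).symm
    exact_mod_cast h2
  · rw [← evalMap_choi, ← hΦY, ampliation_vecMulVec, (hherm S hS).eq]

/-- For each `ψ` the same `φ` and `Φ` serve both `N` and `E`, so data processing under `Φ` bounds
each term on the left by a term of the right-hand supremum. -/
theorem channelDivergence_superchannel_le {div : (S : QSystem) → S.Op → S.Op → EReal}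
    (hdiv : IsGeneralizedDivergence div) (hΞ : IsSuperchannel Ξ) {N E : Op A →ₗ[ℂ] Op B}
    (hN : IsChannel N) (hE : IsCompletelyPositive E) :
    channelDivergence div (Ξ N) (Ξ E) ≤ channelDivergence div N E := by
  refine iSup_le fun ψ => ?_
  obtain ⟨φ, Φ, hφ, hΦ, h⟩ := hΞ.exists_channel ψ.2
  rw [← h N, ← h E]
  have hρ := isState_vecMulVec hφ
  refine (hdiv (A.tensor B) (C.tensor D) Φ hΦ _ _ ?_ ?_).trans ?_
  · exact (hN.isChannel_ampliation (ι := A.Basis)).isState hρ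
  · exact hE.posSemidef_ampliation hρ.1
  · exact le_iSup (fun φ : {φ : A.Basis × A.Basis → ℂ // ∑ i, ‖φ i‖ ^ 2 = 1} =>
      div (A.tensor B) (ampliation A.Basis N (Matrix.vecMulVec φ.1 (star φ.1)))
        (ampliation A.Basis E (Matrix.vecMulVec φ.1 (star φ.1)))) ⟨φ, hφ⟩

end Monotonicity

end

theorem mainTheorem5
    (div : (S : QSystem) → S.Op → S.Op → EReal) (hdiv : IsGeneralizedDivergence div)
    {A B C D : QSystem}
    (N : A.Op →ₗ[ℂ] B.Op) (hN : IsChannel N)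
    (Ξ : (A.Op →ₗ[ℂ] B.Op) →ₗ[ℂ] (C.Op →ₗ[ℂ] D.Op)) (hΞ : IsCPWPSuperchannel Ξ) :
    thauma div (Ξ N) ≤ thauma div N := by
  refine le_iInf fun E => ?_
  have hcp := isCompletelyPositive_superMap Ξ hΞ.1.isCompletelyPositive_superChoi E.2.1
  have hmana : mana (Ξ E.1) ≤ 0 :=
    (mana_nonpos_iff _).2 (hΞ.wignerTraceNorm_le ((mana_nonpos_iff _).1 E.2.2))
  exact (iInf_le (fun E : {E : C.Op →ₗ[ℂ] D.Op // IsCompletelyPositive E ∧ mana E ≤ 0} =>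
    channelDivergence div (Ξ N) E.1) ⟨Ξ E.1, hcp, hmana⟩).trans
    (channelDivergence_superchannel_le hdiv hΞ.1 hN E.2.1)
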